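/- Let $(\xi_t)_{t\ge 1}$ be i.i.d. random variables with values in $\{1,2,\dots\}$, with $\mathbb{E}\,\xi_1^{1+\delta}<\infty$ for some $\delta>0$ and $\mathbb{P}(\xi_1=1)<1$, and let $(\theta_t)_{t\ge 1}$ be i.i.d. uniform on $[0,1]$, independent of $(\xi_t)_{t\ge1}$. Define random directed acyclic graphs $G_t=G_t(f_1)$ with vertex set $\{0,1,\dots,t\}$ as follows. $G_0$ is the single vertex $0$, the root, without edges. For $t\ge 1$, $G_t$ arises from $G_{t-1}$ by adding the vertex $t$ and one edge $(t,v)$ from $t$ to $v$, where $v=f_1(G_{(t-\xi_t)_+},\theta_t)$ is a uniformly random leaf of $G_{(t-\xi_t)_+}$, selected with the help of $\theta_t$: if the leaves are $v_0<\dots<v_{L-1}$, then $v=v_i$ with $i=\min\{\lfloor L\theta_t\rfloor,L-1\}$. Here $x_+=\max\{x,0\}$, and a leaf is a vertex of in-degree zero. On rooted, locally finite, connected directed acyclic graphs, with vertices marked by distinct natural numbers, let $d_*(G,H)=1/(1+s)$, where $s\in\{0,1,\dots,\infty\}$ is the supremum of the integers such that the balls of radius $s$ around the roots, in the undirected hop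 distance, agree as rooted marked directed graphs (with $\sup\emptyset=0$ and $1/\infty=0$). A ray is a semi-infinite directed path; two rays are equivalent if some ray meets each of them in infinitely many vertices; an end is an equivalence class of rays. Then, almost surely, $G_t$ converges in $d_*$ as $t\to\infty$ to a rooted, locally finite, connected directed acyclic graph $G_\infty(f_1)$, and $G_\infty(f_1)$ has infinitely many ends. Furthermore, the number $L_t$ of leaves of $G_t$ is integrable for every $t$, and $$\mathbb{E}\,L_t=\Theta(t^{1/2})\qquad (t\to\infty).$$ -/

import Mathlib

open MeasureTheory ProbabilityTheory Filter Topology Asymptotics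
open scoped ENNReal

noncomputable section

/-- A rooted directed graph whose vertices carry pairwise distinct natural numbers as marks; a vertex
is identified with its mark. `Edge u v` says that there is a directed edge from `u` to `v`. -/
@[ext]
structure MarkedDigraph where
  verts : Set ℕ
  root : ℕ
  Edge : ℕ → ℕ → Prop

namespace MarkedDigraph

/-- The underlying undirected graph; it measures the hop distance. -/
def underlying (G : MarkedDigraph) : SimpleGraph ℕ := SimpleGraph.fromRel G.Edge

/-- The rooted, locally finite, connected directed acyclic graphs. -/
structure IsLocallyFiniteDAG (G : MarkedDigraph) : Prop where
  root_mem : G.root ∈ G.verts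
  edge_mem : ∀ u v, G.Edge u v → u ∈ G.verts ∧ v ∈ G.verts
  acyclic : ∀ v, ¬ Relation.TransGen G.Edge v v
  connected : ∀ v ∈ G.verts, G.underlying.Reachable G.root v
  locallyFinite : ∀ v ∈ G.verts, {u | G.Edge u v ∨ G.Edge v u}.Finite

/-- The vertices at hop distance at most `s` from the root. -/
def ball (G : MarkedDigraph) (s : ℕ) : Set ℕ :=
  {v | v ∈ G.verts ∧ G.underlying.edist G.root v ≤ (s : ℕ∞)}

/-- The `s`-balls around the roots agree, as rooted marked directed graphs. -/
def BallsAgree (G H : MarkedDigraph) (s : ℕ) : Prop :=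
  G.root = H.root ∧ G.ball s = H.ball s ∧
    ∀ u ∈ G.ball s, ∀ v ∈ G.ball s, G.Edge u v ↔ H.Edge u v

/-- The supremum, possibly infinite, of the radii at which the balls around the roots agree. -/
def agreement (G H : MarkedDigraph) : ℕ∞ :=
  ⨆ s : {s : ℕ // BallsAgree G H s}, ((s : ℕ) : ℕ∞)

/-- The local metric `1 / (1 + s)`, where `s` is the supremum of the radii at which the balls around
the roots agree; it is `0` if that supremum is infinite. -/
def dStar (G H : MarkedDigraph) : ℝ :=
  ((1 + (agreement G H : ℝ≥0∞))⁻¹).toReal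

/-- A ray is a semi-infinite directed path. It is listed from its end point, so its edges
point either all towards that end point or all away from it. -/
def IsRay (G : MarkedDigraph) (p : ℕ → ℕ) : Prop :=
  (∀ n, G.Edge (p (n + 1)) (p n)) ∨ (∀ n, G.Edge (p n) (p (n + 1)))

/-- Two rays are equivalent if some ray meets each of them in infinitely many vertices. -/
def RayEquiv (G : MarkedDigraph) (p q : ℕ → ℕ) : Prop :=
  ∃ r, G.IsRay r ∧ (Set.range p ∩ Set.range r).Infinite ∧ (Set.range q ∩ Set.range r).Infinite

/-- The ends: the equivalence classes of rays. -/
def ends (G : MarkedDigraph) : Set (Set (ℕ → ℕ)) :=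
  {C | ∃ p, G.IsRay p ∧ C = {q | G.IsRay q ∧ G.RayEquiv p q}}

/-- The leaves: the vertices of in-degree zero. -/
def leaves (G : MarkedDigraph) : Set ℕ := {v | v ∈ G.verts ∧ ∀ u, ¬ G.Edge u v}

/-- The number of leaves. -/
def numLeaves (G : MarkedDigraph) : ℕ := G.leaves.ncard

/-- The graph with the single vertex `0`, its root, and no edges. -/
def single : MarkedDigraph where
  verts := {0}
  root := 0
  Edge := fun _ _ => False

/-- Add a vertex `t` with edges from `t` to all vertices in `S`. -/
def attach (G : MarkedDigraph) (t : ℕ) (S : Set ℕ) : MarkedDigraph where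
  verts := insert t G.verts
  root := G.root
  Edge := fun u v => G.Edge u v ∨ (u = t ∧ v ∈ S)

end MarkedDigraph

/-- A construction function maps a graph and a number in `[0, 1]` to a set of vertices. -/
abbrev ConstructionFunction := MarkedDigraph → ℝ → Set ℕ

/-- The asynchronous composition model started from a single vertex. Here `x n` is the delay
and `u n` the driving number of vertex `n + 1`, which therefore connects to the vertices in
`f(G_{(n + 1 - x n)₊}, u n)`; truncated subtraction is the positive part. Delays are at least one,
and a value `0` would be read as `1`. -/
def acm (f : ConstructionFunction) (x : ℕ → ℕ) (u : ℕ → ℝ) : ℕ → MarkedDigraph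
  | 0 => MarkedDigraph.single
  | n + 1 => (acm f x u n).attach (n + 1) (f (acm f x u (n + 1 - max (x n) 1)) (u n))
termination_by t => t
decreasing_by all_goals omega

/-- The construction function `f₁`: a single leaf, chosen uniformly at random. Of the `L` leaves,
listed by increasing mark with indices `0, …, L - 1`, it takes the one with index `⌊L u⌋`
(and the last one if `u = 1`). -/
def uniformLeaf : ConstructionFunction := fun G u =>
  {Nat.nth (· ∈ G.leaves) (min ⌊(G.numLeaves : ℝ) * u⌋₊ (G.numLeaves - 1))}

end

noncomputable section

namespace LeafModel

/-! A step changes the number of leaves `L` by 0 or 1. It gains one exactly when the leaf drawn from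
the delayed graph has already been lost by time `t`. If the delay leads back to `G_s`, this has
conditional probability equal to the number of leaves of `G_s` lost by time `t`, divided by `L_s`.

Upper bound: at most one leaf is lost per step, so the loss is at most the delay, and `L_t` times
the conditional probability is at most twice the delay (`card_leafSet_mul_card_sdiff_le`). Hence
E[L_t · gain] is bounded, E[L_t²] grows at most linearly, and E[L_t] is O(√t).

Lower bound: some delay `k + 2` has probability `p > 0`. With this delay, step `s + k + 1` looks
back at `G_s`. A step `s` without gain has removed a leaf of `G_s`, so the later step gains with
conditional probability at least `p / L_s` (`mul_integral_le_integral_gainAt`). Jensen and summation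
give p·n ≤ 2 E[L_{n+k+1}]².

Limit: a vertex that stays a leaf is chosen at step `t` with probability at least `p / (t + 1)`. The
harmonic series diverges, so almost surely every vertex gets a child. By Borel–Cantelli the delayed
times tend to infinity, so a vertex with one child has only finitely many. The limit graph is
therefore locally finite and its balls stabilise. Out-degrees are at most one, so rays through
different leaves of one `G_t` are inequivalent; as `L_t` is almost surely unbounded, there are
infinitely many ends. -/

/-- The element of `A` selected by `y`: with the elements of `A` listed in increasing order, it has
index `⌊|A| y⌋`, or the largest index if that is too large. -/
def pick (A : Finset ℕ) (y : ℝ) : ℕ :=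
  Nat.nth (· ∈ A) (min ⌊(A.card : ℝ) * y⌋₊ (A.card - 1))

theorem pick_mem {A : Finset ℕ} (hA : A.Nonempty) (y : ℝ) : pick A y ∈ A := by
  have hf : {v | v ∈ A}.Finite := A.finite_toSet
  refine Nat.nth_mem_of_lt_card hf ?_
  have h1 : hf.toFinset = A := by ext; simp
  have h2 := hA.card_pos
  rw [h1]
  omega

open Classical in
/-- The leaves at time `t`, as a finite set. -/
def leafSet (x : ℕ → ℕ) (u : ℕ → ℝ) (t : ℕ) : Finset ℕ :=
  {v ∈ Finset.range (t + 1) | v ∈ (acm uniformLeaf x u t).leaves}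

/-- The vertex to which the vertex `t + 1` attaches. -/
def parent (x : ℕ → ℕ) (u : ℕ → ℝ) (t : ℕ) : ℕ :=
  pick (leafSet x u (t + 1 - max (x t) 1)) (u t)

/-! ### Evolution of the leaf set for fixed delays and driving numbers -/

section Deterministic

variable (x : ℕ → ℕ) (u : ℕ → ℝ)

theorem verts_acm (t : ℕ) : (acm uniformLeaf x u t).verts = Set.Iic t := by
  induction t with
  | zero => rw [acm]; ext; simp [MarkedDigraph.single]
  | succ n ih =>
    rw [acm]
    ext v
    simp only [MarkedDigraph.attach, ih, Set.mem_insert_iff, Set.mem_Iic]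
    omega

theorem root_acm (t : ℕ) : (acm uniformLeaf x u t).root = 0 := by
  induction t with
  | zero => rw [acm]; rfl
  | succ n ih => rw [acm]; exact ih

theorem mem_leafSet {t v : ℕ} : v ∈ leafSet x u t ↔ v ∈ (acm uniformLeaf x u t).leaves := by
  simp only [leafSet, Finset.mem_filter, Finset.mem_range, and_iff_right_iff_imp]
  intro h
  have := h.1
  rw [verts_acm, Set.mem_Iic] at this
  omega

theorem coe_leafSet (t : ℕ) : (leafSet x u t : Set ℕ) = (acm uniformLeaf x u t).leaves := by
  ext v
  exact mem_leafSet x u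

theorem numLeaves_acm (t : ℕ) : (acm uniformLeaf x u t).numLeaves = (leafSet x u t).card := by
  rw [MarkedDigraph.numLeaves, ← coe_leafSet, Set.ncard_coe_finset]

theorem uniformLeaf_acm (t : ℕ) (y : ℝ) :
    uniformLeaf (acm uniformLeaf x u t) y = {pick (leafSet x u t) y} := by
  simp only [uniformLeaf, pick, numLeaves_acm, mem_leafSet]

theorem acm_succ (t : ℕ) :
    acm uniformLeaf x u (t + 1) = (acm uniformLeaf x u t).attach (t + 1) {parent x u t} := by
  rw [acm, uniformLeaf_acm]
  rfl

theorem edge_acm {t a b : ℕ} :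
    (acm uniformLeaf x u t).Edge a b ↔ ∃ s < t, a = s + 1 ∧ b = parent x u s := by
  induction t with
  | zero => rw [acm]; simp [MarkedDigraph.single]
  | succ n ih =>
    rw [acm_succ]
    simp only [MarkedDigraph.attach, ih, Set.mem_singleton_iff]
    constructor
    · rintro (⟨s, hs, h⟩ | h)
      · exact ⟨s, by omega, h⟩
      · exact ⟨n, by omega, h⟩
    · rintro ⟨s, hs, h⟩
      rcases Nat.lt_succ_iff_lt_or_eq.1 hs with h' | rfl
      · exact Or.inl ⟨s, h', h⟩
      · exact Or.inr h

theorem mem_leafSet_iff {t v : ℕ} : v ∈ leafSet x u t ↔ v ≤ t ∧ ∀ s < t, parent x u s ≠ v := by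
  rw [mem_leafSet, MarkedDigraph.leaves, Set.mem_ofPred_eq, verts_acm, Set.mem_Iic]
  refine and_congr_right fun _ => ?_
  simp only [edge_acm]
  constructor
  · intro h s hs e
    exact h (s + 1) ⟨s, hs, rfl, e.symm⟩
  · rintro h a ⟨s, hs, -, e⟩
    exact h s hs e.symm

/-- Every step before `t` draws from a graph older than `t`. The strong induction supplies the
nonempty earlier leaf sets without which `pick` could return a default value. -/
theorem self_mem_leafSet (t : ℕ) : t ∈ leafSet x u t := by
  induction t using Nat.strong_induction_on with
  | _ t ih =>
    refine (mem_leafSet_iff x u).2 ⟨le_rfl, fun s hs e => ?_⟩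
    have h := pick_mem ⟨_, ih (s + 1 - max (x s) 1) (by omega)⟩ (u s)
    have h' := ((mem_leafSet_iff x u).1 h).1
    change parent x u s ≤ _ at h'
    omega

theorem leafSet_nonempty (t : ℕ) : (leafSet x u t).Nonempty := ⟨t, self_mem_leafSet x u t⟩

theorem card_leafSet_pos (t : ℕ) : 0 < (leafSet x u t).card := (leafSet_nonempty x u t).card_pos

theorem parent_mem (t : ℕ) : parent x u t ∈ leafSet x u (t + 1 - max (x t) 1) :=
  pick_mem (leafSet_nonempty x u _) _

theorem parent_le (t : ℕ) : parent x u t ≤ t := by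
  have h := ((mem_leafSet_iff x u).1 (parent_mem x u t)).1
  omega

theorem leafSet_zero : leafSet x u 0 = {0} := by
  ext v
  simp [mem_leafSet_iff]

theorem leafSet_succ (t : ℕ) :
    leafSet x u (t + 1) = insert (t + 1) ((leafSet x u t).erase (parent x u t)) := by
  ext v
  have hp := parent_le x u t
  by_cases hv : v = t + 1
  · subst hv
    simp [self_mem_leafSet]
  · simp only [Finset.mem_insert, hv, false_or, Finset.mem_erase, mem_leafSet_iff,
      Nat.lt_succ_iff_lt_or_eq]
    constructor
    · rintro ⟨h1, h2⟩
      exact ⟨fun e => h2 t (Or.inr rfl) e.symm, by omega, fun s hs => h2 s (Or.inl hs)⟩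
    · rintro ⟨h1, h2, h3⟩
      refine ⟨by omega, fun s hs => ?_⟩
      rcases hs with hs | rfl
      · exact h3 s hs
      · exact Ne.symm h1

/-- The increment of the number of leaves in the step from `t` to `t + 1`. -/
def gain (t : ℕ) : ℕ := if parent x u t ∈ leafSet x u t then 0 else 1

theorem gain_le_one (t : ℕ) : gain x u t ≤ 1 := by
  unfold gain
  split_ifs <;> simp

theorem card_leafSet_succ (t : ℕ) :
    (leafSet x u (t + 1)).card = (leafSet x u t).card + gain x u t := by
  have hn : t + 1 ∉ leafSet x u t := fun h => by
    have := ((mem_leafSet_iff x u).1 h).1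
    omega
  rw [leafSet_succ, Finset.card_insert_of_notMem (fun h => hn (Finset.mem_of_mem_erase h)), gain]
  have := card_leafSet_pos x u t
  split_ifs with h
  · rw [Finset.card_erase_of_mem h]
    omega
  · rw [Finset.erase_eq_of_notMem h]

theorem card_leafSet_mono : Monotone fun t => (leafSet x u t).card :=
  monotone_nat_of_le_succ fun t => by
    simp only [card_leafSet_succ]
    omega

theorem card_leafSet_add_le (s k : ℕ) :
    (leafSet x u (s + k)).card ≤ (leafSet x u s).card + k := by
  induction k with
  | zero => simp
  | succ k ih =>
    have h := card_leafSet_succ x u (s + k)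
    have h' := gain_le_one x u (s + k)
    rw [← add_assoc]
    omega

theorem card_leafSet_le (t : ℕ) : (leafSet x u t).card ≤ t + 1 := by
  have := card_leafSet_add_le x u 0 t
  rw [leafSet_zero, zero_add, Finset.card_singleton] at this
  omega

theorem mem_leafSet_of_le {s t v : ℕ} (hst : s ≤ t) (hvs : v ≤ s) (h : v ∈ leafSet x u t) :
    v ∈ leafSet x u s :=
  (mem_leafSet_iff x u).2
    ⟨hvs, fun r hr => ((mem_leafSet_iff x u).1 h).2 r (by omega)⟩

/-- At most one leaf is lost per step. -/
theorem card_sdiff_le (s k : ℕ) :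
    (leafSet x u s \ leafSet x u (s + k)).card ≤ k := by
  have : leafSet x u s \ leafSet x u (s + k) ⊆
      (Finset.range k).image fun i => parent x u (s + i) := by
    intro v hv
    rw [Finset.mem_sdiff] at hv
    obtain ⟨h1, h2⟩ := hv
    rw [mem_leafSet_iff] at h1 h2
    push Not at h2
    obtain ⟨r, hr, e⟩ := h2 (by omega)
    have hsr : s ≤ r := by
      by_contra! hlt
      exact h1.2 r hlt e
    refine Finset.mem_image.2 ⟨r - s, by simp; omega, ?_⟩
    rw [← e]
    congr 1
    omega
  refine (Finset.card_le_card this).trans (Finset.card_image_le.trans ?_)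
  simp

/-- A step without gain removes a leaf for good. -/
theorem one_sub_gain_le_card_sdiff {s t : ℕ} (hst : s < t) :
    1 - gain x u s ≤ (leafSet x u s \ leafSet x u t).card := by
  unfold gain
  split_ifs with h
  · refine Finset.card_pos.2 ⟨parent x u s, Finset.mem_sdiff.2 ⟨h, fun h' => ?_⟩⟩
    exact ((mem_leafSet_iff x u).1 h').2 s hst rfl
  · simp

/-- Over the `j ≤ k` steps from `s` to `t` the loss is at most `j` and at most `L_s`, while `L_t ≤
L_s + j`. So the product is at most `L_s j + j L_s`. It lets the weight `L_t` cancel the denominator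
of the gain probability. -/
theorem card_leafSet_mul_card_sdiff_le (t k : ℕ) :
    (leafSet x u t).card * (leafSet x u (t + 1 - max k 1) \ leafSet x u t).card ≤
      2 * k * (leafSet x u (t + 1 - max k 1)).card := by
  set s := t + 1 - max k 1 with hs
  obtain ⟨j, hj⟩ : ∃ j, t = s + j := ⟨t - s, by omega⟩
  have hjk : j ≤ k := by omega
  have h1 : (leafSet x u s \ leafSet x u t).card ≤ j := hj ▸ card_sdiff_le x u s j
  have h2 : (leafSet x u t).card ≤ (leafSet x u s).card + j := hj ▸ card_leafSet_add_le x u s j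
  have h3 : (leafSet x u s \ leafSet x u t).card ≤ (leafSet x u s).card :=
    Finset.card_le_card Finset.sdiff_subset
  nlinarith

/-! ### The limit graph: local convergence and ends -/

/-- The limit graph. -/
def limitGraph : MarkedDigraph where
  verts := Set.univ
  root := 0
  Edge := fun a b => ∃ s, a = s + 1 ∧ b = parent x u s

variable {x u}

theorem lt_of_edge {a b : ℕ} (h : (limitGraph x u).Edge a b) : b < a := by
  obtain ⟨s, rfl, rfl⟩ := h
  have := parent_le x u s
  omega

theorem edge_rightUnique : Relator.RightUnique (limitGraph x u).Edge := by
  rintro a b c ⟨s, hs, rfl⟩ ⟨r, hr, rfl⟩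
  obtain rfl : s = r := by omega
  rfl

theorem le_of_reflTransGen {a b : ℕ} (h : Relation.ReflTransGen (limitGraph x u).Edge a b) :
    b ≤ a := by
  induction h with
  | refl => exact le_rfl
  | tail _ h ih => exact (lt_of_edge h).le.trans ih

theorem adj_limitGraph_iff {a b : ℕ} : (limitGraph x u).underlying.Adj a b ↔
    (limitGraph x u).Edge a b ∨ (limitGraph x u).Edge b a := by
  rw [MarkedDigraph.underlying, SimpleGraph.fromRel_adj]
  refine and_iff_right_iff_imp.2 ?_
  rintro (h | h) rfl <;> exact lt_irrefl _ (lt_of_edge h)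

theorem limitGraph_reachable (v : ℕ) : (limitGraph x u).underlying.Reachable 0 v := by
  induction v using Nat.strong_induction_on with
  | _ v ih =>
    rcases v with _ | s
    · exact SimpleGraph.Reachable.refl _
    · refine (ih (parent x u s) (Nat.lt_succ_of_le (parent_le x u s))).trans ?_
      exact (adj_limitGraph_iff.2 (Or.inr ⟨s, rfl, rfl⟩)).reachable

theorem isLocallyFiniteDAG_limitGraph (hfin : ∀ v, {s | parent x u s = v}.Finite) :
    (limitGraph x u).IsLocallyFiniteDAG where
  root_mem := trivial
  edge_mem _ _ _ := ⟨trivial, trivial⟩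
  acyclic v h := by
    have key : ∀ a b, Relation.TransGen (limitGraph x u).Edge a b → b < a := by
      intro a b h
      induction h with
      | single h => exact lt_of_edge h
      | tail _ h ih => exact (lt_of_edge h).trans ih
    exact lt_irrefl _ (key v v h)
  connected v _ := limitGraph_reachable v
  locallyFinite v _ := by
    refine (((hfin v).image (· + 1)).union (Set.finite_Iic v)).subset ?_
    rintro w (⟨s, rfl, h⟩ | h)
    · exact Or.inl ⟨s, h.symm, rfl⟩
    · exact Or.inr (lt_of_edge h).le

theorem underlying_acm_le (t : ℕ) :
    (acm uniformLeaf x u t).underlying ≤ (limitGraph x u).underlying := by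
  intro a b h
  rw [MarkedDigraph.underlying, SimpleGraph.fromRel_adj] at h
  rw [MarkedDigraph.underlying, SimpleGraph.fromRel_adj]
  refine ⟨h.1, h.2.imp ?_ ?_⟩ <;> intro h
  all_goals
    obtain ⟨s, -, h⟩ := (edge_acm x u).1 h
    exact ⟨s, h⟩

theorem ball_limitGraph_finite (hfin : ∀ v, {s | parent x u s = v}.Finite) (n : ℕ) :
    ((limitGraph x u).ball n).Finite := by
  induction n with
  | zero =>
    refine (Set.finite_singleton 0).subset ?_
    rintro v ⟨-, hv⟩
    have : (limitGraph x u).underlying.edist 0 v = 0 := nonpos_iff_eq_zero.1 hv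
    exact (SimpleGraph.edist_eq_zero_iff.1 this).symm
  | succ n ih =>
    refine (ih.union (ih.biUnion fun v _ =>
      (isLocallyFiniteDAG_limitGraph hfin).locallyFinite v trivial)).subset ?_
    rintro v ⟨-, hv⟩
    change (limitGraph x u).underlying.edist 0 v ≤ _ at hv
    obtain ⟨p, hp⟩ := (limitGraph_reachable v).exists_walk_length_eq_edist
    rw [← hp] at hv
    have hlen : p.length ≤ n + 1 := by exact_mod_cast hv
    by_cases hnil : p.Nil
    · left
      refine ⟨trivial, ?_⟩
      change (limitGraph x u).underlying.edist 0 v ≤ _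
      rw [← hp, SimpleGraph.Walk.length_eq_zero_iff.2 hnil]
      simp
    · right
      have hadj := p.adj_penultimate hnil
      simp only [Set.mem_iUnion]
      refine ⟨p.penultimate, ⟨trivial, ?_⟩, (adj_limitGraph_iff.1 hadj).symm⟩
      refine (SimpleGraph.Walk.edist_le p.dropLast).trans ?_
      have : p.dropLast.length = p.length - 1 := by simp
      rw [this]
      exact_mod_cast (by omega : p.length - 1 ≤ n)

/-- From some time on, the balls of radius `n` no longer change. -/
theorem eventually_ballsAgree (hfin : ∀ v, {s | parent x u s = v}.Finite) (n : ℕ) :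
    ∀ᶠ t in atTop, (acm uniformLeaf x u t).BallsAgree (limitGraph x u) n := by
  obtain ⟨T, hT⟩ := (ball_limitGraph_finite hfin n).bddAbove
  filter_upwards [eventually_ge_atTop T] with t ht
  -- The only edge out of a vertex is created together with it, so all edges starting in the ball
  -- are present once `t` exceeds every mark in the ball.
  have hedge : ∀ a b, a ∈ (limitGraph x u).ball n → (limitGraph x u).Edge a b →
      (acm uniformLeaf x u t).Edge a b := by
    rintro a b ha ⟨s, rfl, rfl⟩
    have := hT ha
    exact (edge_acm x u).2 ⟨s, by omega, rfl, rfl⟩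
  -- A shortest path in the limit graph stays inside the ball, hence survives in `G_t`.
  have hwalk : ∀ k ≤ n, ∀ v, (limitGraph x u).underlying.edist 0 v ≤ (k : ℕ∞) →
      (acm uniformLeaf x u t).underlying.edist 0 v ≤ (k : ℕ∞) := by
    intro k
    induction k with
    | zero =>
      intro _ v hv
      have : (limitGraph x u).underlying.edist 0 v = 0 := by simpa using hv
      rw [SimpleGraph.edist_eq_zero_iff.1 this]
      simp
    | succ k ih =>
      intro hk v hv
      obtain ⟨p, hp⟩ := (limitGraph_reachable v).exists_walk_length_eq_edist
      have hv' := hv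
      rw [← hp] at hv'
      have hlen : p.length ≤ k + 1 := by exact_mod_cast hv'
      by_cases hnil : p.Nil
      · obtain rfl := hnil.eq
        simp
      · have hadj := p.adj_penultimate hnil
        have hw : (limitGraph x u).underlying.edist 0 p.penultimate ≤ (k : ℕ∞) := by
          refine (SimpleGraph.Walk.edist_le p.dropLast).trans ?_
          have : p.dropLast.length = p.length - 1 := by simp
          rw [this]
          exact_mod_cast (by omega : p.length - 1 ≤ k)
        have hw' := ih (by omega) _ hw
        have hadj' : (acm uniformLeaf x u t).underlying.Adj p.penultimate v := by
          refine (SimpleGraph.fromRel_adj _ _ _).2 ⟨hadj.ne, ?_⟩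
          refine (adj_limitGraph_iff.1 hadj).imp (hedge _ _ ⟨trivial, ?_⟩)
            (hedge _ _ ⟨trivial, ?_⟩)
          · exact hw.trans (by exact_mod_cast (by omega : k ≤ n))
          · exact hv.trans (by exact_mod_cast hk)
        refine (SimpleGraph.edist_triangle (v := p.penultimate)).trans ?_
        rw [SimpleGraph.edist_eq_one_iff_adj.2 hadj']
        push_cast
        gcongr
  have hball : (acm uniformLeaf x u t).ball n = (limitGraph x u).ball n := by
    ext v
    constructor
    · rintro ⟨-, hv⟩
      rw [root_acm] at hv
      exact ⟨trivial, (SimpleGraph.edist_anti (underlying_acm_le t)).trans hv⟩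
    · intro hv
      refine ⟨?_, ?_⟩
      · rw [verts_acm]
        exact (hT hv).trans ht
      · rw [root_acm]
        exact hwalk n le_rfl v hv.2
  refine ⟨root_acm x u t, hball, fun a ha b _ => ⟨fun h => ?_, hedge a b (hball ▸ ha)⟩⟩
  obtain ⟨s, -, h⟩ := (edge_acm x u).1 h
  exact ⟨s, h⟩

theorem tendsto_dStar_limitGraph (hfin : ∀ v, {s | parent x u s = v}.Finite) :
    Tendsto (fun t => MarkedDigraph.dStar (acm uniformLeaf x u t) (limitGraph x u))
      atTop (𝓝 0) := by
  have hle : ∀ n : ℕ, ∀ᶠ t in atTop,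
      MarkedDigraph.dStar (acm uniformLeaf x u t) (limitGraph x u) ≤ 1 / ((n : ℝ) + 1) := by
    intro n
    filter_upwards [eventually_ballsAgree hfin n] with t ht
    have h1 : (n : ℕ∞) ≤ MarkedDigraph.agreement (acm uniformLeaf x u t) (limitGraph x u) :=
      le_iSup (fun s : {s : ℕ // MarkedDigraph.BallsAgree _ _ s} => ((s : ℕ) : ℕ∞)) ⟨n, ht⟩
    have h2 : (n : ℝ≥0∞) ≤
        (MarkedDigraph.agreement (acm uniformLeaf x u t) (limitGraph x u) : ℝ≥0∞) := by
      exact_mod_cast ENat.toENNReal_le.2 h1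
    have h3 : (1 + (MarkedDigraph.agreement (acm uniformLeaf x u t)
        (limitGraph x u) : ℝ≥0∞))⁻¹ ≤ (1 + (n : ℝ≥0∞))⁻¹ := by
      gcongr
    have h4 := ENNReal.toReal_mono (by simp) h3
    refine h4.trans (le_of_eq ?_)
    rw [ENNReal.toReal_inv, ENNReal.toReal_add (by simp) (by simp)]
    simp [add_comm]
  rw [Metric.tendsto_nhds]
  intro ε hε
  obtain ⟨n, hn⟩ := exists_nat_one_div_lt hε
  filter_upwards [hle n] with t ht
  rw [Real.dist_eq, sub_zero, MarkedDigraph.dStar, abs_of_nonneg ENNReal.toReal_nonneg]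
  exact ht.trans_lt hn

/-- Marks decrease along edges, so no infinite path follows the edges forward. -/
theorem isRay_iff_edge_succ {p : ℕ → ℕ} :
    (limitGraph x u).IsRay p ↔ ∀ n, (limitGraph x u).Edge (p (n + 1)) (p n) := by
  refine ⟨fun h => h.resolve_right fun h => ?_, Or.inl⟩
  have hanti : StrictAnti p := strictAnti_nat_of_succ_lt fun n => lt_of_edge (h n)
  exact not_strictAnti_of_wellFoundedLT p hanti

theorem reflTransGen_of_ray {p : ℕ → ℕ}
    (hp : ∀ n, (limitGraph x u).Edge (p (n + 1)) (p n)) {i j : ℕ} (hij : i ≤ j) :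
    Relation.ReflTransGen (limitGraph x u).Edge (p j) (p i) := by
  induction j, hij using Nat.le_induction with
  | base => exact .refl
  | succ j _ ih => exact .head (hp j) ih

/-- No leaf of `G_t` is an ancestor of another vertex of `G_t`. -/
theorem eq_of_reflTransGen_of_mem_leafSet {t v w : ℕ} (hv : v ∈ leafSet x u t) (hw : w ≤ t)
    (h : Relation.ReflTransGen (limitGraph x u).Edge w v) : v = w := by
  rcases Relation.ReflTransGen.cases_tail h with h | ⟨c, hc, s, hs, hvs⟩
  · exact h
  · have := le_of_reflTransGen hc
    exact absurd hvs.symm (((mem_leafSet_iff x u).1 hv).2 s (by omega))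

/-- If every vertex has a child and the number of leaves is unbounded, then there are infinitely
many ends. -/
theorem ends_limitGraph_infinite (hchild : ∀ v, ∃ s, parent x u s = v)
    (hL : ∀ k, ∃ t, k < (leafSet x u t).card) : (limitGraph x u).ends.Infinite := by
  choose c hc using hchild
  let ray : ℕ → ℕ → ℕ := fun v n => (fun w => c w + 1)^[n] v
  have hray : ∀ v n, (limitGraph x u).Edge (ray v (n + 1)) (ray v n) := by
    intro v n
    refine ⟨c (ray v n), ?_, (hc _).symm⟩
    simp only [ray, Function.iterate_succ_apply']
  have hisRay : ∀ v, (limitGraph x u).IsRay (ray v) := fun v => Or.inl (hray v)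
  let C : ℕ → Set (ℕ → ℕ) := fun v =>
    {q | (limitGraph x u).IsRay q ∧ (limitGraph x u).RayEquiv (ray v) q}
  have hmono : ∀ p : ℕ → ℕ, (∀ n, (limitGraph x u).Edge (p (n + 1)) (p n)) → StrictMono p :=
    fun p hp => strictMono_nat_of_lt_succ fun n => lt_of_edge (hp n)
  -- Rays climbing from distinct leaves of the same `G_t` are inequivalent.
  have hinj : ∀ t, Set.InjOn C (leafSet x u t) := by
    intro t v hv w hw hvw
    have hself : ray w ∈ C w := by
      have : (Set.range (ray w) ∩ Set.range (ray w)).Infinite := by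
        rw [Set.inter_self]
        exact Set.infinite_range_of_injective (hmono _ (hray w)).injective
      exact ⟨hisRay w, ray w, hisRay w, this, this⟩
    rw [← hvw] at hself
    obtain ⟨-, r, hr, h1, h2⟩ := hself
    rw [isRay_iff_edge_succ] at hr
    obtain ⟨_, ⟨i, hi⟩, j, rfl⟩ := h1.nonempty
    -- The meeting point with the second ray is taken above `r j`, so that directed paths lead from
    -- `r j'` to both `v` and `w`. As out-degrees are at most one, one of these paths extends the
    -- other.
    obtain ⟨_, ⟨⟨i', hi'⟩, j', rfl⟩, hlt⟩ := h2.exists_gt (r j)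
    have hjj : j ≤ j' := ((hmono r hr).lt_iff_lt.1 hlt).le
    have hav : Relation.ReflTransGen (limitGraph x u).Edge (r j') v := by
      refine (reflTransGen_of_ray hr hjj).trans ?_
      rw [← hi]
      exact reflTransGen_of_ray (hray v) (Nat.zero_le i)
    have haw : Relation.ReflTransGen (limitGraph x u).Edge (r j') w := by
      rw [← hi']
      exact reflTransGen_of_ray (hray w) (Nat.zero_le i')
    rcases Relation.ReflTransGen.total_of_right_unique edge_rightUnique hav haw with h | h
    · exact (eq_of_reflTransGen_of_mem_leafSet hw ((mem_leafSet_iff x u).1 hv).1 h).symm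
    · exact eq_of_reflTransGen_of_mem_leafSet hv ((mem_leafSet_iff x u).1 hw).1 h
  intro hfin
  obtain ⟨t, ht⟩ := hL (limitGraph x u).ends.ncard
  have hsub : C '' (leafSet x u t) ⊆ (limitGraph x u).ends := by
    rintro _ ⟨v, -, rfl⟩
    exact ⟨ray v, hisRay v, rfl⟩
  have h1 := Set.ncard_le_ncard hsub hfin
  rw [(hinj t).ncard_image, Set.ncard_coe_finset] at h1
  omega

/-- If the delays grow slowly enough, a vertex that has a child has finitely many of them. -/
theorem finite_children (hslow : ∀ c, ∀ᶠ s in atTop, x s + c ≤ s) {v : ℕ}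
    (hchild : ∃ s, parent x u s = v) : {s | parent x u s = v}.Finite := by
  obtain ⟨r, hr⟩ := hchild
  -- The offset `r + 1` pushes the delayed time beyond `r`, after which `v` is no longer a leaf.
  obtain ⟨T, hT⟩ := eventually_atTop.1 (hslow (r + 1))
  refine (Set.finite_Iio (max T (r + 2))).subset fun s hs => ?_
  by_contra! hlt
  simp only [Set.mem_Iio, not_lt, sup_le_iff] at hlt
  have h1 := hT s hlt.1
  have h2 := parent_mem x u s
  rw [Set.mem_ofPred_eq] at hs
  rw [hs, mem_leafSet_iff] at h2
  exact h2.2 r (by omega) hr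

end Deterministic

/-! ### Measurability of the leaf sets -/

section Measurability

theorem measurable_pick : Measurable fun q : Finset ℕ × ℝ => pick q.1 q.2 := by
  refine measurable_from_prod_countable_right fun A => ?_
  exact (Measurable.of_discrete (f := fun n : ℕ => Nat.nth (· ∈ A) (min n (A.card - 1)))).comp
    (Nat.measurable_floor.comp (measurable_const_mul (A.card : ℝ)))

variable {Ω : Type*} [MeasurableSpace Ω] {ξ : ℕ → Ω → ℕ} {θ : ℕ → Ω → ℝ}

/-- Meant for the delayed graph, whose time is random: split according to the finitely many values
of that time. -/
theorem measurable_eval_of_le {β : Type*} [MeasurableSpace β] {F : ℕ → Ω → β} {t : ℕ}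
    (hF : ∀ s ≤ t, Measurable (F s)) {k : Ω → ℕ} (hk : Measurable k) (hkt : ∀ ω, k ω ≤ t) :
    Measurable fun ω => F (k ω) ω := by
  intro S hS
  have : (fun ω => F (k ω) ω) ⁻¹' S = ⋃ s ∈ Set.Iic t, (k ⁻¹' {s} ∩ F s ⁻¹' S) := by
    ext ω
    simp only [Set.mem_preimage, Set.mem_iUnion, Set.mem_inter_iff, Set.mem_singleton_iff,
      Set.mem_Iic, exists_prop]
    constructor
    · intro h
      exact ⟨k ω, hkt ω, rfl, h⟩
    · rintro ⟨s, -, rfl, h⟩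
      exact h
  rw [this]
  exact MeasurableSet.biUnion (Set.to_countable _) fun s hs =>
    (hk (measurableSet_singleton s)).inter (hF s hs hS)

/-- Only inputs with index below `t` enter, so the lemma also applies with a history as the
σ-algebra on `Ω` and yields adaptedness. -/
theorem measurable_leafSet {t : ℕ} (hξ : ∀ i < t, Measurable (ξ i))
    (hθ : ∀ i < t, Measurable (θ i)) :
    Measurable fun ω => leafSet (fun n => ξ n ω) (fun n => θ n ω) t := by
  induction t using Nat.strong_induction_on with
  | _ t ih =>
    rcases t with _ | t
    · simp only [leafSet_zero]
      exact measurable_const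
    · have hF : ∀ s ≤ t, Measurable fun ω => leafSet (fun n => ξ n ω) (fun n => θ n ω) s :=
        fun s hs => ih s (by omega) (fun i hi => hξ i (by omega)) fun i hi => hθ i (by omega)
      have hk : Measurable fun ω => t + 1 - max (ξ t ω) 1 :=
        (Measurable.of_discrete (f := fun n : ℕ => t + 1 - max n 1)).comp (hξ t (by omega))
      have hpar : Measurable fun ω => parent (fun n => ξ n ω) (fun n => θ n ω) t :=
        measurable_pick.comp ((measurable_eval_of_le hF hk fun ω => by omega).prodMk
          (hθ t (by omega)))
      simp only [leafSet_succ]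
      exact (Measurable.of_discrete (f := fun q : Finset ℕ × ℕ =>
        insert (t + 1) (q.1.erase q.2))).comp ((hF t le_rfl).prodMk hpar)

theorem measurable_delayed_leafSet {t : ℕ} (hξ : ∀ i < t + 1, Measurable (ξ i))
    (hθ : ∀ i < t, Measurable (θ i)) :
    Measurable fun ω => leafSet (fun n => ξ n ω) (fun n => θ n ω) (t + 1 - max (ξ t ω) 1) := by
  refine measurable_eval_of_le (t := t)
    (F := fun s ω => leafSet (fun n => ξ n ω) (fun n => θ n ω) s)
    (fun s hs => measurable_leafSet (fun i hi => hξ i (by omega)) fun i hi => hθ i (by omega))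
    ?_ fun ω => by omega
  exact (Measurable.of_discrete (f := fun n : ℕ => t + 1 - max n 1)).comp (hξ t (by omega))

theorem measurable_parent {t : ℕ} (hξ : ∀ i < t + 1, Measurable (ξ i))
    (hθ : ∀ i < t + 1, Measurable (θ i)) :
    Measurable fun ω => parent (fun n => ξ n ω) (fun n => θ n ω) t :=
  measurable_pick.comp ((measurable_delayed_leafSet hξ fun i hi => hθ i (by omega)).prodMk
    (hθ t (by omega)))

theorem measurable_gain {t : ℕ} (hξ : ∀ i < t + 1, Measurable (ξ i))
    (hθ : ∀ i < t + 1, Measurable (θ i)) :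
    Measurable fun ω => gain (fun n => ξ n ω) (fun n => θ n ω) t :=
  (Measurable.of_discrete (f := fun q : Finset ℕ × ℕ => if q.2 ∈ q.1 then 0 else 1)).comp
    ((measurable_leafSet (fun i hi => hξ i (by omega)) fun i hi => hθ i (by omega)).prodMk
      (measurable_parent hξ hθ))

theorem measurable_card_leafSet {t : ℕ} (hξ : ∀ i < t, Measurable (ξ i))
    (hθ : ∀ i < t, Measurable (θ i)) :
    Measurable fun ω => ((leafSet (fun n => ξ n ω) (fun n => θ n ω) t).card : ℝ) :=
  (Measurable.of_discrete (f := fun A : Finset ℕ => (A.card : ℝ))).comp (measurable_leafSet hξ hθ)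

end Measurability

/-! ### Uniformity of the selected leaf -/

section Uniform

/-- Each element of `A` is selected with the same probability. -/
theorem measureReal_pick_eq {A : Finset ℕ} {v : ℕ} (hv : v ∈ A) :
    (volume.restrict (Set.Icc (0 : ℝ) 1)).real {y | pick A y = v} = 1 / A.card := by
  have hf : {w | w ∈ A}.Finite := A.finite_toSet
  have hA : hf.toFinset = A := by ext; simp
  obtain ⟨i, hi, hiv⟩ := Nat.exists_lt_card_finite_nth_eq hf hv
  rw [hA] at hi
  have hL : (0 : ℝ) < A.card := by exact_mod_cast (Nat.zero_le i).trans_lt hi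
  have hset : {y | pick A y = v} ∩ Set.Ico (0 : ℝ) 1 =
      Set.Ico ((i : ℝ) / A.card) (((i : ℝ) + 1) / A.card) := by
    have hequiv : ∀ y ∈ Set.Ico (0 : ℝ) 1, (pick A y = v ↔ ⌊(A.card : ℝ) * y⌋₊ = i) := by
      intro y hy
      have hlt : ⌊(A.card : ℝ) * y⌋₊ < A.card := by
        rw [Nat.floor_lt (by have := hy.1; positivity)]
        nlinarith [hy.2]
      rw [pick, min_eq_left (by omega), ← hiv]
      constructor
      · intro h
        exact Nat.nth_injOn hf (by simpa [hA] using hlt) (by simpa [hA] using hi) h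
      · intro h
        rw [h]
    ext y
    rw [Set.mem_inter_iff, Set.mem_ofPred_eq, Set.mem_Ico (a := (i : ℝ) / A.card),
      div_le_iff₀ hL, lt_div_iff₀ hL]
    constructor
    · rintro ⟨h1, h2⟩
      rw [hequiv y h2, Nat.floor_eq_iff (by have := h2.1; positivity)] at h1
      constructor <;> nlinarith [h1.1, h1.2]
    · rintro ⟨h1, h2⟩
      have hi' : (i : ℝ) + 1 ≤ A.card := by exact_mod_cast hi
      have hi0 : (0 : ℝ) ≤ i := Nat.cast_nonneg i
      have h0 : 0 ≤ y := nonneg_of_mul_nonneg_left (hi0.trans h1) hL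
      have hy : y ∈ Set.Ico (0 : ℝ) 1 := ⟨h0, by nlinarith⟩
      refine ⟨(hequiv y hy).2 ?_, hy⟩
      rw [Nat.floor_eq_iff (by positivity)]
      constructor <;> nlinarith
  have hmeas : MeasurableSet {y | pick A y = v} :=
    (measurable_pick.comp (measurable_prodMk_left (x := A))) (measurableSet_singleton v)
  -- The endpoint 1, where the cap in `pick` takes effect, is a null set.
  rw [← Measure.restrict_congr_set (Ico_ae_eq_Icc (a := (0 : ℝ)) (b := 1)),
    measureReal_restrict_apply hmeas, hset, Real.volume_real_Ico_of_le (by gcongr; linarith)]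
  ring

theorem measureReal_pick_mem {A : Finset ℕ} (hA : A.Nonempty) (S : Finset ℕ) :
    (volume.restrict (Set.Icc (0 : ℝ) 1)).real {y | pick A y ∈ S} = (A ∩ S).card / A.card := by
  have hset : {y | pick A y ∈ S} = ⋃ v ∈ A ∩ S, {y | pick A y = v} := by
    ext y
    simp only [Set.mem_ofPred_eq, Set.mem_iUnion, exists_prop, exists_eq_right',
      Finset.mem_inter, pick_mem hA y, true_and]
  rw [hset, measureReal_biUnion_finset]
  · rw [Finset.sum_congr rfl fun v hv => measureReal_pick_eq (Finset.mem_inter.1 hv).1]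
    simp [div_eq_mul_inv]
  · intro v _ w _ hvw
    refine Set.disjoint_left.2 fun y h1 h2 => hvw ?_
    exact Eq.trans (Eq.symm h1) h2
  · intro v _
    exact (measurable_pick.comp (measurable_prodMk_left (x := A))) (measurableSet_singleton v)

end Uniform

/-! ### Independence and histories -/

section Independence

variable {Ω : Type*} {mΩ : MeasurableSpace Ω} {μ : Measure Ω}

/-- Freezing: the independent variable is integrated out first, with the other held fixed. -/
theorem integral_comp_of_indepFun {α β : Type*} [MeasurableSpace α] [MeasurableSpace β]
    [IsProbabilityMeasure μ]
    {X : Ω → α} {Y : Ω → β} (hX : Measurable X) (hY : Measurable Y) (h : IndepFun X Y μ)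
    {f : α × β → ℝ} (hf : Measurable f) (hint : Integrable (fun ω => f (X ω, Y ω)) μ) :
    ∫ ω, f (X ω, Y ω) ∂μ = ∫ ω, ∫ y, f (X ω, y) ∂(μ.map Y) ∂μ := by
  have hmap := (indepFun_iff_map_prod_eq_prod_map_map hX.aemeasurable hY.aemeasurable).1 h
  have : IsProbabilityMeasure (μ.map Y) := Measure.isProbabilityMeasure_map hY.aemeasurable
  have : IsProbabilityMeasure (μ.map X) := Measure.isProbabilityMeasure_map hX.aemeasurable
  have hint' : Integrable f ((μ.map X).prod (μ.map Y)) := by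
    rw [← hmap]
    exact (integrable_map_measure hf.aestronglyMeasurable (hX.prodMk hY).aemeasurable).2 hint
  calc ∫ ω, f (X ω, Y ω) ∂μ = ∫ q, f q ∂(μ.map fun ω => (X ω, Y ω)) :=
        (integral_map (hX.prodMk hY).aemeasurable hf.aestronglyMeasurable).symm
    _ = ∫ a, ∫ y, f (a, y) ∂(μ.map Y) ∂(μ.map X) := by rw [hmap, integral_prod _ hint']
    _ = _ := by
        rw [integral_map hX.aemeasurable]
        exact hf.stronglyMeasurable.integral_prod_right'.aestronglyMeasurable

/-- The σ-algebras generated by the single delays and the single driving numbers. -/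
@[reducible]
def sourceAlgebra (ξ : ℕ → Ω → ℕ) (θ : ℕ → Ω → ℝ) : ℕ ⊕ ℕ → MeasurableSpace Ω :=
  Sum.elim (fun n => MeasurableSpace.comap (ξ n) inferInstance)
    (fun n => MeasurableSpace.comap (θ n) inferInstance)

/-- The σ-algebra generated by the first `j` delays and the first `k` driving numbers. -/
@[reducible]
def history (ξ : ℕ → Ω → ℕ) (θ : ℕ → Ω → ℝ) (j k : ℕ) : MeasurableSpace Ω :=
  ⨆ i ∈ {i | Sum.elim (· < j) (· < k) i}, sourceAlgebra ξ θ i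

variable {ξ : ℕ → Ω → ℕ} {θ : ℕ → Ω → ℝ}

theorem iIndep_sourceAlgebra (hξ_indep : iIndepFun ξ μ) (hθ_indep : iIndepFun θ μ)
    (hξθ_indep : IndepFun (fun ω n => ξ n ω) (fun ω n => θ n ω) μ) :
    iIndep (sourceAlgebra ξ θ) μ := by
  rw [iIndep_iff]
  intro s f hf
  have hl : ∀ i ∈ s.toLeft, MeasurableSet[MeasurableSpace.comap (ξ i) inferInstance]
      (f (Sum.inl i)) := fun i hi => hf (Sum.inl i) (Finset.mem_toLeft.1 hi)
  have hr : ∀ i ∈ s.toRight, MeasurableSet[MeasurableSpace.comap (θ i) inferInstance]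
      (f (Sum.inr i)) := fun i hi => hf (Sum.inr i) (Finset.mem_toRight.1 hi)
  have hinter : ⋂ i ∈ s, f i =
      (⋂ i ∈ s.toLeft, f (Sum.inl i)) ∩ ⋂ i ∈ s.toRight, f (Sum.inr i) := by
    ext ω
    simp
  have hle_l : ∀ i, MeasurableSpace.comap (ξ i) inferInstance ≤
      MeasurableSpace.comap (fun ω n => ξ n ω) inferInstance := fun i => by
    rw [← measurable_iff_comap_le]
    exact (measurable_pi_apply i).comp (comap_measurable fun ω n => ξ n ω)
  have hle_r : ∀ i, MeasurableSpace.comap (θ i) inferInstance ≤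
      MeasurableSpace.comap (fun ω n => θ n ω) inferInstance := fun i => by
    rw [← measurable_iff_comap_le]
    exact (measurable_pi_apply i).comp (comap_measurable fun ω n => θ n ω)
  have hprod := (Indep_iff _ _ _).1 ((IndepFun_iff_Indep _ _ _).1 hξθ_indep)
    (⋂ i ∈ s.toLeft, f (Sum.inl i)) (⋂ i ∈ s.toRight, f (Sum.inr i))
    (Finset.measurableSet_biInter _ fun i hi => hle_l i _ (hl i hi))
    (Finset.measurableSet_biInter _ fun i hi => hle_r i _ (hr i hi))
  rw [hinter, hprod, hξ_indep.iIndep.meas_biInter hl, hθ_indep.iIndep.meas_biInter hr]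
  conv_rhs => rw [← Finset.toLeft_disjSum_toRight (u := s)]
  rw [Finset.prod_disjSum]

theorem sourceAlgebra_le (hξ : ∀ n, Measurable (ξ n)) (hθ : ∀ n, Measurable (θ n))
    (i : ℕ ⊕ ℕ) : sourceAlgebra ξ θ i ≤ mΩ := by
  rcases i with n | n
  · exact (hξ n).comap_le
  · exact (hθ n).comap_le

theorem history_le (hξ : ∀ n, Measurable (ξ n)) (hθ : ∀ n, Measurable (θ n)) (j k : ℕ) :
    history ξ θ j k ≤ mΩ :=
  iSup₂_le fun i _ => sourceAlgebra_le hξ hθ i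

theorem measurable_delay_history {i j : ℕ} (k : ℕ) (hij : i < j) :
    Measurable[history ξ θ j k] (ξ i) := by
  rw [measurable_iff_comap_le]
  exact le_iSup₂_of_le (f := fun i (_ : i ∈ {i | Sum.elim (· < j) (· < k) i}) =>
    sourceAlgebra ξ θ i) (Sum.inl i) hij le_rfl

theorem measurable_number_history {i k : ℕ} (j : ℕ) (hik : i < k) :
    Measurable[history ξ θ j k] (θ i) := by
  rw [measurable_iff_comap_le]
  exact le_iSup₂_of_le (f := fun i (_ : i ∈ {i | Sum.elim (· < j) (· < k) i}) =>
    sourceAlgebra ξ θ i) (Sum.inr i) hik le_rfl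

/-- The two indices of `history` allow step `t` to be revealed in two halves: `history t t` precedes
its delay, and `history (t + 1) t` includes the delay but not the driving number. -/
theorem indepFun_number_of_history (hm : ∀ i, sourceAlgebra ξ θ i ≤ mΩ)
    (hind : iIndep (sourceAlgebra ξ θ) μ) {α : Type*} [MeasurableSpace α] {X : Ω → α} {j t : ℕ}
    (hX : Measurable[history ξ θ j t] X) : IndepFun X (θ t) μ := by
  rw [IndepFun_iff_Indep]
  refine indep_of_indep_of_le_left (indep_of_indep_of_le_right
    (indep_iSup_of_disjoint hm hind (S := {i | Sum.elim (· < j) (· < t) i}) (T := {Sum.inr t})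
      ?_) ?_) (measurable_iff_comap_le.1 hX)
  · simp
  · exact le_iSup₂_of_le (f := fun i (_ : i ∈ ({Sum.inr t} : Set (ℕ ⊕ ℕ))) =>
      sourceAlgebra ξ θ i) (Sum.inr t) rfl le_rfl

theorem indepFun_delay_of_history (hm : ∀ i, sourceAlgebra ξ θ i ≤ mΩ)
    (hind : iIndep (sourceAlgebra ξ θ) μ) {α : Type*} [MeasurableSpace α] {X : Ω → α} {k t : ℕ}
    (hX : Measurable[history ξ θ t k] X) : IndepFun X (ξ t) μ := by
  rw [IndepFun_iff_Indep]
  refine indep_of_indep_of_le_left (indep_of_indep_of_le_right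
    (indep_iSup_of_disjoint hm hind (S := {i | Sum.elim (· < t) (· < k) i}) (T := {Sum.inl t})
      ?_) ?_) (measurable_iff_comap_le.1 hX)
  · simp
  · exact le_iSup₂_of_le (f := fun i (_ : i ∈ ({Sum.inl t} : Set (ℕ ⊕ ℕ))) =>
      sourceAlgebra ξ θ i) (Sum.inl t) rfl le_rfl

end Independence

/-! ### The random leaf process and its conditional increments -/

variable {Ω : Type*} {mΩ : MeasurableSpace Ω}

/-- Independent, identically distributed delays and independent uniform driving numbers. -/
structure IsDriving (μ : Measure Ω) (ξ : ℕ → Ω → ℕ) (θ : ℕ → Ω → ℝ) : Prop where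
  measurable_delay : ∀ n, Measurable (ξ n)
  measurable_number : ∀ n, Measurable (θ n)
  iIndep_source : iIndep (sourceAlgebra ξ θ) μ
  identDistrib : ∀ n, IdentDistrib (ξ n) (ξ 0) μ μ
  uniform : ∀ n, μ.map (θ n) = volume.restrict (Set.Icc (0 : ℝ) 1)

/-- The random set of leaves at time `t`. -/
def leavesAt (ξ : ℕ → Ω → ℕ) (θ : ℕ → Ω → ℝ) (t : ℕ) (ω : Ω) : Finset ℕ :=
  leafSet (fun n => ξ n ω) (fun n => θ n ω) t

/-- The random vertex to which `t + 1` attaches. -/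
def parentAt (ξ : ℕ → Ω → ℕ) (θ : ℕ → Ω → ℝ) (t : ℕ) (ω : Ω) : ℕ :=
  parent (fun n => ξ n ω) (fun n => θ n ω) t

/-- The random number of leaves at time `t`. -/
def count (ξ : ℕ → Ω → ℕ) (θ : ℕ → Ω → ℝ) (t : ℕ) (ω : Ω) : ℝ := (leavesAt ξ θ t ω).card

/-- The random increment of the number of leaves. -/
def gainAt (ξ : ℕ → Ω → ℕ) (θ : ℕ → Ω → ℝ) (t : ℕ) (ω : Ω) : ℝ :=
  gain (fun n => ξ n ω) (fun n => θ n ω) t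

variable {μ : Measure Ω} {ξ : ℕ → Ω → ℕ} {θ : ℕ → Ω → ℝ}

theorem one_le_count (t : ℕ) (ω : Ω) : 1 ≤ count ξ θ t ω := by
  have := card_leafSet_pos (fun n => ξ n ω) (fun n => θ n ω) t
  unfold count leavesAt
  exact_mod_cast this

theorem count_pos (t : ℕ) (ω : Ω) : 0 < count ξ θ t ω := zero_lt_one.trans_le (one_le_count t ω)

theorem count_le (t : ℕ) (ω : Ω) : count ξ θ t ω ≤ t + 1 := by
  have := card_leafSet_le (fun n => ξ n ω) (fun n => θ n ω) t
  unfold count leavesAt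
  exact_mod_cast this

theorem count_zero (ω : Ω) : count ξ θ 0 ω = 1 := by
  simp [count, leavesAt, leafSet_zero]

theorem count_succ (t : ℕ) (ω : Ω) : count ξ θ (t + 1) ω = count ξ θ t ω + gainAt ξ θ t ω := by
  have := card_leafSet_succ (fun n => ξ n ω) (fun n => θ n ω) t
  unfold count leavesAt gainAt
  exact_mod_cast this

theorem count_mono (ω : Ω) : Monotone fun t => count ξ θ t ω := fun s t hst => by
  have := card_leafSet_mono (fun n => ξ n ω) (fun n => θ n ω) hst
  simp only [count, leavesAt]
  exact_mod_cast this

theorem gainAt_nonneg (t : ℕ) (ω : Ω) : 0 ≤ gainAt ξ θ t ω := Nat.cast_nonneg _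

theorem gainAt_le_one (t : ℕ) (ω : Ω) : gainAt ξ θ t ω ≤ 1 := by
  have := gain_le_one (fun n => ξ n ω) (fun n => θ n ω) t
  unfold gainAt
  exact_mod_cast this

theorem one_sub_gainAt_le {s t : ℕ} (hst : s < t) (ω : Ω) :
    1 - gainAt ξ θ s ω ≤ (leavesAt ξ θ s ω \ leavesAt ξ θ t ω).card := by
  have := one_sub_gain_le_card_sdiff (fun n => ξ n ω) (fun n => θ n ω) hst
  have h : 1 ≤ gain (fun n => ξ n ω) (fun n => θ n ω) s +
    (leafSet (fun n => ξ n ω) (fun n => θ n ω) s \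
      leafSet (fun n => ξ n ω) (fun n => θ n ω) t).card := by omega
  unfold gainAt leavesAt
  rw [sub_le_iff_le_add']
  exact_mod_cast h

/-- The parent always lies in the delayed leaf set, so not being a current leaf means being one of
the leaves lost since. In this form the uniform choice gives the gain probability. -/
theorem gainAt_eq_ite (t : ℕ) (ω : Ω) : gainAt ξ θ t ω =
    if parentAt ξ θ t ω ∈ leavesAt ξ θ (t + 1 - max (ξ t ω) 1) ω \ leavesAt ξ θ t ω
      then 1 else 0 := by
  have h := parent_mem (fun n => ξ n ω) (fun n => θ n ω) t
  simp only [gainAt, gain, parentAt, leavesAt, Finset.mem_sdiff, h, true_and]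
  split_ifs <;> simp_all

theorem measurable_leavesAt_history {s j k : ℕ} (hj : s ≤ j) (hk : s ≤ k) :
    Measurable[history ξ θ j k] (leavesAt ξ θ s) :=
  @measurable_leafSet Ω (history ξ θ j k) ξ θ s
    (fun _ hi => measurable_delay_history k (by omega))
    (fun _ hi => measurable_number_history j (by omega))

theorem measurable_count_history {s j k : ℕ} (hj : s ≤ j) (hk : s ≤ k) :
    Measurable[history ξ θ j k] (count ξ θ s) :=
  @measurable_card_leafSet Ω (history ξ θ j k) ξ θ s
    (fun _ hi => measurable_delay_history k (by omega))
    (fun _ hi => measurable_number_history j (by omega))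

theorem measurable_gainAt_history {s j k : ℕ} (hj : s < j) (hk : s < k) :
    Measurable[history ξ θ j k] (gainAt ξ θ s) :=
  (@Measurable.of_discrete _ _ _ _ _ (fun n : ℕ => (n : ℝ))).comp <|
    @measurable_gain Ω (history ξ θ j k) ξ θ s
      (fun _ hi => measurable_delay_history k (by omega))
      (fun _ hi => measurable_number_history j (by omega))

namespace IsDriving

variable (h : IsDriving μ ξ θ)

include h

theorem history_le (j k : ℕ) : history ξ θ j k ≤ mΩ :=
  LeafModel.history_le h.measurable_delay h.measurable_number j k

theorem source_le (i : ℕ ⊕ ℕ) : sourceAlgebra ξ θ i ≤ mΩ :=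
  sourceAlgebra_le h.measurable_delay h.measurable_number i

theorem measurable_leavesAt (t : ℕ) : Measurable (leavesAt ξ θ t) :=
  (measurable_leavesAt_history le_rfl le_rfl).mono (h.history_le t t) le_rfl

theorem measurable_count (t : ℕ) : Measurable (count ξ θ t) :=
  (measurable_count_history le_rfl le_rfl).mono (h.history_le t t) le_rfl

theorem measurable_gainAt (t : ℕ) : Measurable (gainAt ξ θ t) :=
  (measurable_gainAt_history (Nat.lt_succ_self t) (Nat.lt_succ_self t)).mono
    (h.history_le (t + 1) (t + 1)) le_rfl

theorem measurable_parentAt (t : ℕ) : Measurable (parentAt ξ θ t) :=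
  measurable_parent (fun i _ => h.measurable_delay i) fun i _ => h.measurable_number i

theorem measurable_delayed (t : ℕ) :
    Measurable fun ω => leavesAt ξ θ (t + 1 - max (ξ t ω) 1) ω :=
  measurable_delayed_leafSet (fun i _ => h.measurable_delay i) fun i _ => h.measurable_number i

theorem integrable_mul_gainAt {W : Ω → ℝ} (hW : Integrable W μ) (t : ℕ) :
    Integrable (fun ω => W ω * gainAt ξ θ t ω) μ :=
  hW.mul_bdd (h.measurable_gainAt t).aestronglyMeasurable (c := 1) <| ae_of_all _ fun ω => by
    rw [Real.norm_of_nonneg (gainAt_nonneg t ω)]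
    exact gainAt_le_one t ω

theorem integrable_mul_lossRatio {W : Ω → ℝ} (hW : Integrable W μ) (t : ℕ) :
    Integrable (fun ω => W ω *
      ((leavesAt ξ θ (t + 1 - max (ξ t ω) 1) ω \ leavesAt ξ θ t ω).card /
        (leavesAt ξ θ (t + 1 - max (ξ t ω) 1) ω).card)) μ := by
  let F : Finset ℕ × Finset ℕ → ℝ := fun q => (q.1 \ q.2).card / q.1.card
  have hF : Measurable F := .of_discrete
  have hm : Measurable fun ω =>
      F (leavesAt ξ θ (t + 1 - max (ξ t ω) 1) ω, leavesAt ξ θ t ω) :=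
    hF.comp ((h.measurable_delayed t).prodMk (h.measurable_leavesAt t))
  refine hW.mul_bdd (c := 1) hm.aestronglyMeasurable (ae_of_all _ fun ω => ?_)
  rw [Real.norm_of_nonneg (by positivity)]
  refine div_le_one_of_le₀ ?_ (by positivity)
  exact_mod_cast Finset.card_le_card Finset.sdiff_subset

theorem integral_mul_delay_eq {t m : ℕ} {W : Ω → ℝ} (hW : Measurable[history ξ θ t t] W) :
    ∫ ω, W ω * (if ξ t ω = m then 1 else 0) ∂μ = μ.real {ω | ξ 0 ω = m} * ∫ ω, W ω ∂μ := by
  have hind : IndepFun W (fun ω => if ξ t ω = m then (1 : ℝ) else 0) μ :=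
    (indepFun_delay_of_history h.source_le h.iIndep_source hW).comp measurable_id
      (Measurable.of_discrete (f := fun n : ℕ => if n = m then (1 : ℝ) else 0))
  have hm : Measurable fun ω => if ξ t ω = m then (1 : ℝ) else 0 :=
    (Measurable.of_discrete (f := fun n : ℕ => if n = m then (1 : ℝ) else 0)).comp
      (h.measurable_delay t)
  rw [hind.integral_fun_mul_eq_mul_integral (hW.mono (h.history_le _ _) le_rfl).aestronglyMeasurable
    hm.aestronglyMeasurable, mul_comm]
  congr 1
  have hset : MeasurableSet {ω | ξ t ω = m} := h.measurable_delay t (measurableSet_singleton m)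
  have h1 : μ.real {ω | ξ 0 ω = m} = μ.real {ω | ξ t ω = m} := by
    have := (h.identDistrib t).measure_mem_eq (measurableSet_singleton m)
    exact congrArg ENNReal.toReal this.symm
  rw [h1, ← integral_indicator_one hset]
  refine integral_congr_ae (ae_of_all _ fun ω => ?_)
  simp [Set.indicator_apply]

variable [IsProbabilityMeasure μ]

theorem integrable_count (t : ℕ) : Integrable (count ξ θ t) μ :=
  .of_bound (h.measurable_count t).aestronglyMeasurable (t + 1) <| ae_of_all _ fun ω => by
    rw [Real.norm_of_nonneg (count_pos t ω).le]
    exact count_le t ω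

theorem integrable_gainAt (t : ℕ) : Integrable (gainAt ξ θ t) μ :=
  .of_bound (h.measurable_gainAt t).aestronglyMeasurable 1 <| ae_of_all _ fun ω => by
    rw [Real.norm_of_nonneg (gainAt_nonneg t ω)]
    exact gainAt_le_one t ω

/-- Conditionally on everything up to the delay of step `t`, the new vertex attaches to a uniformly
random leaf of the delayed graph. -/
theorem integral_mul_parentAt_mem {t : ℕ} {W : Ω → ℝ} (hW : Measurable[history ξ θ (t + 1) t] W)
    (hWi : Integrable W μ) {S : Ω → Finset ℕ} (hS : Measurable[history ξ θ (t + 1) t] S) :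
    ∫ ω, W ω * (if parentAt ξ θ t ω ∈ S ω then 1 else 0) ∂μ =
      ∫ ω, W ω * ((leavesAt ξ θ (t + 1 - max (ξ t ω) 1) ω ∩ S ω).card /
        (leavesAt ξ θ (t + 1 - max (ξ t ω) 1) ω).card) ∂μ := by
  let A : Ω → Finset ℕ := fun ω => leavesAt ξ θ (t + 1 - max (ξ t ω) 1) ω
  have hA : Measurable[history ξ θ (t + 1) t] A :=
    @measurable_delayed_leafSet Ω (history ξ θ (t + 1) t) ξ θ t
      (fun _ hi => measurable_delay_history t hi)
      (fun _ hi => measurable_number_history (t + 1) hi)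
  have hX : Measurable[history ξ θ (t + 1) t] fun ω => (W ω, A ω, S ω) :=
    hW.prodMk (hA.prodMk hS)
  have hX' : Measurable fun ω => (W ω, A ω, S ω) := hX.mono (h.history_le _ _) le_rfl
  let f : (ℝ × Finset ℕ × Finset ℕ) × ℝ → ℝ := fun q =>
    q.1.1 * (if pick q.1.2.1 q.2 ∈ q.1.2.2 then 1 else 0)
  have hf : Measurable f := by
    refine measurable_fst.fst.mul ?_
    exact (Measurable.of_discrete (f := fun q : ℕ × Finset ℕ =>
      if q.1 ∈ q.2 then (1 : ℝ) else 0)).comp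
      ((measurable_pick.comp (measurable_fst.snd.fst.prodMk measurable_snd)).prodMk
        measurable_fst.snd.snd)
  have hint : Integrable (fun ω => f ((W ω, A ω, S ω), θ t ω)) μ := by
    refine hWi.mono (hf.comp (hX'.prodMk (h.measurable_number t))).aestronglyMeasurable
      (ae_of_all _ fun ω => ?_)
    simp only [f]
    split_ifs <;> simp
  refine (integral_comp_of_indepFun hX' (h.measurable_number t)
    (indepFun_number_of_history h.source_le h.iIndep_source hX) hf hint).trans ?_
  refine integral_congr_ae (ae_of_all _ fun ω => ?_)
  simp only [f]
  rw [integral_const_mul, h.uniform t, 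
    ← measureReal_pick_mem (A := leavesAt ξ θ (t + 1 - max (ξ t ω) 1) ω)
      (leafSet_nonempty _ _ _) (S ω)]
  congr 1
  have hm : MeasurableSet {y | pick (A ω) y ∈ S ω} :=
    (measurable_pick.comp (measurable_prodMk_left (x := A ω)))
      (MeasurableSet.of_discrete (s := {n | n ∈ S ω}))
  rw [← integral_indicator_one hm]
  refine integral_congr_ae (ae_of_all _ fun y => ?_)
  simp [Set.indicator_apply]

theorem integral_mul_gainAt {t : ℕ} {W : Ω → ℝ} (hW : Measurable[history ξ θ (t + 1) t] W)
    (hWi : Integrable W μ) :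
    ∫ ω, W ω * gainAt ξ θ t ω ∂μ =
      ∫ ω, W ω * ((leavesAt ξ θ (t + 1 - max (ξ t ω) 1) ω \ leavesAt ξ θ t ω).card /
        (leavesAt ξ θ (t + 1 - max (ξ t ω) 1) ω).card) ∂μ := by
  have hS : Measurable[history ξ θ (t + 1) t] fun ω =>
      leavesAt ξ θ (t + 1 - max (ξ t ω) 1) ω \ leavesAt ξ θ t ω :=
    (@Measurable.of_discrete _ _ _ _ _ (fun q : Finset ℕ × Finset ℕ => q.1 \ q.2)).comp
      ((@measurable_delayed_leafSet Ω (history ξ θ (t + 1) t) ξ θ t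
        (fun _ hi => measurable_delay_history t hi)
        (fun _ hi => measurable_number_history (t + 1) hi)).prodMk
        (measurable_leavesAt_history (Nat.le_succ t) le_rfl))
  simp only [gainAt_eq_ite]
  rw [h.integral_mul_parentAt_mem hW hWi hS]
  simp only [Finset.inter_eq_right.2 Finset.sdiff_subset]

/-- The basic lower bound for the increments. -/
theorem mul_integral_le_integral_gainAt {s t k : ℕ} (ht : t = s + k + 1) {W : Ω → ℝ}
    (hW : Measurable[history ξ θ t t] W) (h0 : ∀ ω, 0 ≤ W ω) (h1 : ∀ ω, W ω ≤ 1) :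
    μ.real {ω | ξ 0 ω = k + 2} * ∫ ω, W ω * ((1 - gainAt ξ θ s ω) / count ξ θ s ω) ∂μ ≤
      ∫ ω, W ω * gainAt ξ θ t ω ∂μ := by
  have hWm : Measurable W := hW.mono (h.history_le _ _) le_rfl
  have hWi : Integrable W μ := .of_bound hWm.aestronglyMeasurable 1 <| ae_of_all _ fun ω => by
    rw [Real.norm_of_nonneg (h0 ω)]
    exact h1 ω
  have hmono : history ξ θ t t ≤ history ξ θ (t + 1) t :=
    iSup₂_mono' fun i hi => ⟨i, by rcases i with i | i <;> simp_all; omega, le_rfl⟩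
  have hq : Measurable[history ξ θ t t] fun ω =>
      W ω * ((1 - gainAt ξ θ s ω) / count ξ θ s ω) :=
    hW.mul (((@measurable_const _ _ _ (history ξ θ t t) (1 : ℝ)).sub
      (measurable_gainAt_history (by omega) (by omega))).div
      (measurable_count_history (by omega) (by omega)))
  let I : Ω → ℝ := fun ω => if ξ t ω = k + 2 then 1 else 0
  have hI : Measurable[history ξ θ (t + 1) t] I :=
    (@Measurable.of_discrete _ _ _ _ _ (fun n : ℕ => if n = k + 2 then (1 : ℝ) else 0)).comp
      (measurable_delay_history t (Nat.lt_succ_self t))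
  have hI' : Measurable I := hI.mono (h.history_le _ _) le_rfl
  have hI0 : ∀ ω, 0 ≤ I ω := fun ω => by simp only [I]; split_ifs <;> simp
  have hI1 : ∀ ω, I ω ≤ 1 := fun ω => by simp only [I]; split_ifs <;> simp
  have hWI : Measurable[history ξ θ (t + 1) t] fun ω => W ω * I ω :=
    (hW.mono hmono le_rfl).mul hI
  have hWIi : Integrable (fun ω => W ω * I ω) μ :=
    hWi.mul_bdd hI'.aestronglyMeasurable (c := 1) <| ae_of_all _ fun ω => by
      rw [Real.norm_of_nonneg (hI0 ω)]
      exact hI1 ω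
  rw [← h.integral_mul_delay_eq (t := t) hq]
  calc ∫ ω, W ω * ((1 - gainAt ξ θ s ω) / count ξ θ s ω) * I ω ∂μ
      ≤ ∫ ω, W ω * I ω * ((leavesAt ξ θ (t + 1 - max (ξ t ω) 1) ω \ leavesAt ξ θ t ω).card /
        (leavesAt ξ θ (t + 1 - max (ξ t ω) 1) ω).card) ∂μ := by
        refine integral_mono_of_nonneg (ae_of_all _ fun ω => ?_) ?_ (ae_of_all _ fun ω => ?_)
        · have := sub_nonneg.2 (gainAt_le_one (ξ := ξ) (θ := θ) s ω)
          have := (count_pos (ξ := ξ) (θ := θ) s ω).le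
          have := h0 ω
          have := hI0 ω
          simp only [Pi.zero_apply]
          positivity
        · exact h.integrable_mul_lossRatio hWIi t
        · simp only [I]
          split_ifs with hk
          · have hs : t + 1 - max (ξ t ω) 1 = s := by omega
            rw [hs, mul_one, mul_one]
            refine mul_le_mul_of_nonneg_left ?_ (h0 ω)
            exact div_le_div_of_nonneg_right (one_sub_gainAt_le (by omega) ω)
              (Nat.cast_nonneg _)
          · simp
    _ = ∫ ω, W ω * I ω * gainAt ξ θ t ω ∂μ := (h.integral_mul_gainAt hWI hWIi).symm
    _ ≤ ∫ ω, W ω * gainAt ξ θ t ω ∂μ := by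
        refine integral_mono (h.integrable_mul_gainAt hWIi t) (h.integrable_mul_gainAt hWi t) ?_
        intro ω
        refine mul_le_mul_of_nonneg_right ?_ (gainAt_nonneg t ω)
        exact mul_le_of_le_one_right (h0 ω) (hI1 ω)

end IsDriving

/-! ### Almost sure properties: children, unbounded leaf number, slow delays -/

/-- The increments gained while there are at most `K` leaves sum to at most `K + 1`. -/
theorem sum_gainAt_le (K n : ℕ) (ω : Ω) :
    ∑ t ∈ Finset.range n, (if count ξ θ t ω ≤ K then 1 else 0) * gainAt ξ θ t ω ≤ K + 1 := by
  -- The bound by the current count carries the induction while the count is at most `K`; afterwards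
  -- the summands vanish.
  suffices hmin : ∑ t ∈ Finset.range n, (if count ξ θ t ω ≤ K then 1 else 0) * gainAt ξ θ t ω ≤
      min (count ξ θ n ω) (K + 1) from hmin.trans (min_le_right _ _)
  induction n with
  | zero =>
    rw [Finset.sum_range_zero]
    exact le_min (count_pos 0 ω).le (by positivity)
  | succ n ih =>
    rw [Finset.sum_range_succ, count_succ]
    have hg := gainAt_nonneg (ξ := ξ) (θ := θ) n ω
    have hg1 := gainAt_le_one (ξ := ξ) (θ := θ) n ω
    have h1 := ih.trans (min_le_left _ _)
    have h2 := ih.trans (min_le_right _ _)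
    split_ifs with hc
    · exact le_min (by linarith) (by linarith)
    · exact le_min (by linarith) (by linarith)

namespace IsDriving

variable (h : IsDriving μ ξ θ) [IsProbabilityMeasure μ]

include h

/-- Almost surely every vertex has a child. -/
theorem ae_exists_parentAt_eq {m : ℕ} (hm : 1 ≤ m) (hp : 0 < μ.real {ω | ξ 0 ω = m}) (v : ℕ) :
    ∀ᵐ ω ∂μ, ∃ s, parentAt ξ θ s ω = v := by
  set p := μ.real {ω | ξ 0 ω = m} with hpdef
  let J : ℕ → Ω → ℝ := fun t ω => if v ∈ leavesAt ξ θ t ω then 1 else 0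
  have hJ : ∀ t j k, t ≤ j → t ≤ k → Measurable[history ξ θ j k] (J t) := fun t j k hj hk =>
    (@Measurable.of_discrete _ _ _ _ _ (fun A : Finset ℕ => if v ∈ A then (1 : ℝ) else 0)).comp
      (measurable_leavesAt_history hj hk)
  have hJm : ∀ t, Measurable (J t) := fun t =>
    (hJ t t t le_rfl le_rfl).mono (h.history_le t t) le_rfl
  have hJ0 : ∀ t ω, 0 ≤ J t ω := fun t ω => by simp only [J]; split_ifs <;> simp
  have hJ1 : ∀ t ω, J t ω ≤ 1 := fun t ω => by simp only [J]; split_ifs <;> simp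
  have hJi : ∀ t, Integrable (J t) μ := fun t =>
    .of_bound (hJm t).aestronglyMeasurable 1 <| ae_of_all _ fun ω => by
      rw [Real.norm_of_nonneg (hJ0 t ω)]
      exact hJ1 t ω
  -- With delay `m` the graph drawn from is `G_{t+1-m}`. It already contains `v`, still as a leaf,
  -- and has at most `t + 1` leaves.
  have hstep : ∀ t, v + m ≤ t → p / (t + 1) * ∫ ω, J t ω ∂μ ≤
      ∫ ω, J t ω ∂μ - ∫ ω, J (t + 1) ω ∂μ := by
    intro t ht
    let I : Ω → ℝ := fun ω => if ξ t ω = m then 1 else 0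
    have hI : Measurable[history ξ θ (t + 1) t] I :=
      (@Measurable.of_discrete _ _ _ _ _ (fun n : ℕ => if n = m then (1 : ℝ) else 0)).comp
        (measurable_delay_history t (Nat.lt_succ_self t))
    have hI0 : ∀ ω, 0 ≤ I ω := fun ω => by simp only [I]; split_ifs <;> simp
    have hI1 : ∀ ω, I ω ≤ 1 := fun ω => by simp only [I]; split_ifs <;> simp
    have hW : Measurable[history ξ θ (t + 1) t] fun ω => J t ω * I ω :=
      (hJ t (t + 1) t (by omega) le_rfl).mul hI
    have hWi : Integrable (fun ω => J t ω * I ω) μ :=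
      (hJi t).mul_bdd (hI.mono (h.history_le _ _) le_rfl).aestronglyMeasurable (c := 1) <|
        ae_of_all _ fun ω => by
          rw [Real.norm_of_nonneg (hI0 ω)]
          exact hI1 ω
    have hkey := h.integral_mul_parentAt_mem hW hWi
      (@measurable_const _ _ _ (history ξ θ (t + 1) t) ({v} : Finset ℕ))
    have hlow : ∫ ω, J t ω * I ω * (1 / (t + 1)) ∂μ ≤
        ∫ ω, J t ω * I ω * (if parentAt ξ θ t ω ∈ ({v} : Finset ℕ) then 1 else 0) ∂μ := by
      rw [hkey]
      refine integral_mono_of_nonneg (ae_of_all _ fun ω => ?_) ?_ (ae_of_all _ fun ω => ?_)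
      · have := hJ0 t ω
        have := hI0 ω
        simp only [Pi.zero_apply]
        positivity
      · let F : Finset ℕ → ℝ := fun A => (A ∩ {v}).card / A.card
        have hF : Measurable F := .of_discrete
        refine hWi.mul_bdd (c := 1) (hF.comp (h.measurable_delayed t)).aestronglyMeasurable
          (ae_of_all _ fun ω => ?_)
        rw [Real.norm_of_nonneg (by positivity)]
        refine div_le_one_of_le₀ ?_ (by positivity)
        exact_mod_cast Finset.card_le_card Finset.inter_subset_left
      · simp only [I, J]
        split_ifs with hv hx <;> simp only [one_mul, mul_zero, zero_mul, le_refl]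
        have hs : t + 1 - max (ξ t ω) 1 = t + 1 - m := by omega
        rw [hs]
        have hmem : v ∈ leavesAt ξ θ (t + 1 - m) ω :=
          mem_leafSet_of_le _ _ (by omega) (by omega) hv
        rw [Finset.inter_singleton_of_mem hmem, Finset.card_singleton, Nat.cast_one]
        have h1 := count_le (ξ := ξ) (θ := θ) (t + 1 - m) ω
        have h2 := count_pos (ξ := ξ) (θ := θ) (t + 1 - m) ω
        have h3 : ((t + 1 - m : ℕ) : ℝ) ≤ t := by exact_mod_cast (by omega : t + 1 - m ≤ t)
        refine one_div_le_one_div_of_le h2 ?_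
        unfold count at h1
        linarith
    have hup : ∫ ω, J t ω * I ω * (if parentAt ξ θ t ω ∈ ({v} : Finset ℕ) then 1 else 0) ∂μ ≤
        ∫ ω, J t ω - J (t + 1) ω ∂μ := by
      refine integral_mono_of_nonneg (ae_of_all _ fun ω => ?_) ((hJi t).sub (hJi (t + 1)))
        (ae_of_all _ fun ω => ?_)
      · have := hJ0 t ω
        have := hI0 ω
        simp only [Pi.zero_apply]
        positivity
      · have hsucc : v ∈ leavesAt ξ θ (t + 1) ω ↔
            v ∈ leavesAt ξ θ t ω ∧ parentAt ξ θ t ω ≠ v := by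
          simp only [leavesAt, leafSet_succ, Finset.mem_insert, Finset.mem_erase, parentAt]
          rw [or_iff_right (by omega), and_comm, ne_comm]
        simp only [J, hsucc, Finset.mem_singleton]
        by_cases hv : v ∈ leavesAt ξ θ t ω <;> by_cases hpv : parentAt ξ θ t ω = v <;>
          simp [hv, hpv, hI1 ω]
    rw [integral_sub (hJi t) (hJi (t + 1))] at hup
    rw [integral_mul_const, h.integral_mul_delay_eq (hJ t t t le_rfl le_rfl)] at hlow
    calc p / (t + 1) * ∫ ω, J t ω ∂μ = p * (∫ ω, J t ω ∂μ) * (1 / (t + 1)) := by ring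
      _ ≤ _ := hlow.trans hup
  let N : Set Ω := {ω | ∀ s, parentAt ξ θ s ω ≠ v}
  have hN : MeasurableSet N := by
    have : N = ⋂ s, (parentAt ξ θ s ⁻¹' {v})ᶜ := by ext; simp [N]
    rw [this]
    exact MeasurableSet.iInter fun s => (h.measurable_parentAt s (measurableSet_singleton v)).compl
  have hNJ : ∀ t, v ≤ t → μ.real N ≤ ∫ ω, J t ω ∂μ := by
    intro t ht
    rw [← integral_indicator_one hN]
    refine integral_mono_of_nonneg (ae_of_all _ fun ω => ?_) (hJi t) (ae_of_all _ fun ω => ?_)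
    · exact Set.indicator_nonneg (fun _ _ => zero_le_one) ω
    · by_cases hω : ω ∈ N
      · have : v ∈ leavesAt ξ θ t ω := (mem_leafSet_iff _ _).2 ⟨ht, fun s _ => hω s⟩
        simp [J, hω, this]
      · simpa [hω] using hJ0 t ω
  -- The decrements of P(`v` is a leaf) telescope to at most 1, yet dominate a multiple of a
  -- harmonic sum.
  have hsum : ∀ n, p * μ.real N * ∑ i ∈ Finset.range n, 1 / ((i + (v + m) : ℕ) + 1 : ℝ) ≤ 1 := by
    intro n
    have htel : ∑ i ∈ Finset.range n, (∫ ω, J (i + (v + m)) ω ∂μ - ∫ ω, J (i + 1 + (v + m)) ω ∂μ) ≤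
        1 := by
      rw [Finset.sum_range_sub' (fun i => ∫ ω, J (i + (v + m)) ω ∂μ)]
      have h1 : ∫ ω, J (0 + (v + m)) ω ∂μ ≤ 1 := by
        have := integral_mono (hJi (0 + (v + m))) (integrable_const 1) (hJ1 _)
        simpa using this
      have h2 : 0 ≤ ∫ ω, J (n + (v + m)) ω ∂μ := integral_nonneg (hJ0 _)
      linarith
    refine le_trans ?_ htel
    rw [Finset.mul_sum]
    refine Finset.sum_le_sum fun i _ => ?_
    have h1 := hstep (i + (v + m)) (by omega)
    have h2 := hNJ (i + (v + m)) (by omega)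
    rw [show i + 1 + (v + m) = i + (v + m) + 1 by ring]
    refine le_trans ?_ h1
    rw [show p * μ.real N * (1 / (((i + (v + m) : ℕ) : ℝ) + 1)) =
      p / (((i + (v + m) : ℕ) : ℝ) + 1) * μ.real N by ring]
    exact mul_le_mul_of_nonneg_left h2 (by positivity)
  have hzero : μ.real N = 0 := by
    by_contra hne
    have hpos : 0 < p * μ.real N := mul_pos hp (lt_of_le_of_ne measureReal_nonneg (Ne.symm hne))
    have hdiv : ¬ Summable fun i : ℕ => 1 / ((i + (v + m) : ℕ) + 1 : ℝ) := by
      have := (summable_nat_add_iff (f := fun i : ℕ => 1 / ((i : ℕ) : ℝ)) (v + m + 1)).not.2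
        Real.not_summable_one_div_natCast
      refine fun hs => this (hs.congr fun i => ?_)
      push_cast
      ring
    refine hdiv (summable_of_sum_range_le (c := 1 / (p * μ.real N)) (fun i => by positivity)
      fun n => ?_)
    rw [le_div_iff₀ hpos, mul_comm]
    exact hsum n
  have hzero' : μ N = 0 := by
    rw [measureReal_def, ENNReal.toReal_eq_zero_iff] at hzero
    exact hzero.resolve_right (measure_ne_top μ N)
  filter_upwards [measure_eq_zero_iff_ae_notMem.1 hzero'] with ω hω
  simpa [N] using hω

/-- Almost surely the number of leaves is unbounded. -/
theorem ae_exists_lt_card {k : ℕ} (hp : 0 < μ.real {ω | ξ 0 ω = k + 2}) :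
    ∀ᵐ ω ∂μ, ∀ K, ∃ t, K < (leavesAt ξ θ t ω).card := by
  rw [ae_all_iff]
  intro K
  set p := μ.real {ω | ξ 0 ω = k + 2} with hpdef
  have hp1 : p ≤ 1 := measureReal_le_one
  let J : ℕ → Ω → ℝ := fun t ω => if count ξ θ t ω ≤ K then 1 else 0
  have hJ : ∀ t, Measurable[history ξ θ t t] (J t) := fun t =>
    (@Measurable.of_discrete _ _ _ _ _
      (fun A : Finset ℕ => if (A.card : ℝ) ≤ K then (1 : ℝ) else 0)).comp
      (measurable_leavesAt_history le_rfl le_rfl)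
  have hJm : ∀ t, Measurable (J t) := fun t => (hJ t).mono (h.history_le t t) le_rfl
  have hJ0 : ∀ t ω, 0 ≤ J t ω := fun t ω => by simp only [J]; split_ifs <;> simp
  have hJ1 : ∀ t ω, J t ω ≤ 1 := fun t ω => by simp only [J]; split_ifs <;> simp
  have hJi : ∀ t, Integrable (J t) μ := fun t =>
    .of_bound (hJm t).aestronglyMeasurable 1 <| ae_of_all _ fun ω => by
      rw [Real.norm_of_nonneg (hJ0 t ω)]
      exact hJ1 t ω
  have hJg : ∀ t, Integrable (fun ω => J t ω * gainAt ξ θ t ω) μ :=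
    fun t => h.integrable_mul_gainAt (hJi t) t
  let g : ℕ → ℝ := fun t => ∫ ω, J t ω * gainAt ξ θ t ω ∂μ
  have hg0 : ∀ t, 0 ≤ g t := fun t =>
    integral_nonneg fun ω => mul_nonneg (hJ0 t ω) (gainAt_nonneg t ω)
  have hgsum : ∀ n, ∑ t ∈ Finset.range n, g t ≤ K + 1 := by
    intro n
    simp only [g]
    rw [← integral_finsetSum _ fun t _ => hJg t]
    have := integral_mono (μ := μ) (integrable_finsetSum (Finset.range n) fun t _ => hJg t)
      (integrable_const ((K : ℝ) + 1)) fun ω => sum_gainAt_le K n ω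
    simpa using this
  let N : Set Ω := {ω | ∀ t, count ξ θ t ω ≤ K}
  have hN : MeasurableSet N := by
    have : N = ⋂ t, count ξ θ t ⁻¹' Set.Iic (K : ℝ) := by ext; simp [N]
    rw [this]
    exact MeasurableSet.iInter fun t => h.measurable_count t measurableSet_Iic
  have hNi : Integrable (N.indicator (1 : Ω → ℝ)) μ := (integrable_const 1).indicator hN
  -- On `N` the count never exceeds `K`, which bounds the denominator in the basic lower bound; off
  -- `N` the left integrand is nonpositive. Using `K + 1` also covers `K = 0`.
  have hstep : ∀ s, p / (K + 1) * (μ.real N - g s) ≤ g (s + (k + 1)) := by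
    intro s
    have hlow := h.mul_integral_le_integral_gainAt (s := s) (t := s + (k + 1)) (k := k) rfl
      (hJ _) (hJ0 _) (hJ1 _)
    refine le_trans ?_ hlow
    rw [div_mul_eq_mul_div, mul_div_assoc]
    refine mul_le_mul_of_nonneg_left ?_ hp.le
    have hsub : μ.real N - g s = ∫ ω, N.indicator (1 : Ω → ℝ) ω - J s ω * gainAt ξ θ s ω ∂μ := by
      rw [integral_sub hNi (hJg s), integral_indicator_one hN]
    rw [hsub, ← integral_div]
    refine integral_mono ((hNi.sub (hJg s)).div_const _) ?_ fun ω => ?_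
    · refine (hJi _).mul_bdd (c := 1) (((measurable_const.sub (h.measurable_gainAt s)).div
        (h.measurable_count s)).aestronglyMeasurable) (ae_of_all _ fun ω => ?_)
      have h1 := gainAt_le_one (ξ := ξ) (θ := θ) s ω
      have h2 := gainAt_nonneg (ξ := ξ) (θ := θ) s ω
      have h3 := one_le_count (ξ := ξ) (θ := θ) s ω
      rw [Real.norm_of_nonneg (div_nonneg (by linarith) (by linarith))]
      exact div_le_one_of_le₀ (by linarith) (by linarith)
    · have h1 := gainAt_le_one (ξ := ξ) (θ := θ) s ω
      have h2 := gainAt_nonneg (ξ := ξ) (θ := θ) s ω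
      have h3 := one_le_count (ξ := ξ) (θ := θ) s ω
      by_cases hω : ω ∈ N
      · have hs : count ξ θ s ω ≤ K := hω s
        have ht : count ξ θ (s + (k + 1)) ω ≤ K := hω _
        simp only [J, hω, Set.indicator_of_mem, Pi.one_apply, hs, ht, if_true, one_mul]
        exact div_le_div_of_nonneg_left (by linarith) (by linarith) (by linarith)
      · simp only [hω, not_false_eq_true, Set.indicator_of_notMem, zero_sub]
        refine (div_nonpos_of_nonpos_of_nonneg ?_ (by positivity)).trans
          (mul_nonneg (hJ0 _ ω) (div_nonneg (by linarith) (by linarith)))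
        exact neg_nonpos.2 (mul_nonneg (hJ0 s ω) h2)
  -- The expected gains `g` have bounded sums, whereas the left side grows linearly unless `N` is
  -- null.
  have hbound : ∀ n : ℕ, p / (K + 1) * (n * μ.real N) ≤ 2 * (K + 1) := by
    intro n
    have h1 : ∑ s ∈ Finset.range n, p / (K + 1) * (μ.real N - g s) ≤
        ∑ s ∈ Finset.range n, g (s + (k + 1)) := Finset.sum_le_sum fun s _ => hstep s
    have h2 : ∑ s ∈ Finset.range n, g (s + (k + 1)) ≤ K + 1 := by
      refine le_trans ?_ (hgsum (n + (k + 1)))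
      rw [add_comm n, Finset.sum_range_add]
      have : 0 ≤ ∑ i ∈ Finset.range (k + 1), g i := Finset.sum_nonneg fun i _ => hg0 i
      simp only [add_comm (k + 1)]
      linarith
    rw [← Finset.mul_sum, Finset.sum_sub_distrib, Finset.sum_const, Finset.card_range,
      nsmul_eq_mul, mul_sub] at h1
    have h3 : p / (K + 1) * ∑ s ∈ Finset.range n, g s ≤ 1 * (K + 1) := by
      refine mul_le_mul ?_ (hgsum n) (Finset.sum_nonneg fun i _ => hg0 i) zero_le_one
      exact div_le_one_of_le₀ (hp1.trans (by linarith [Nat.cast_nonneg (α := ℝ) K]))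
        (by positivity)
    linarith
  have hzero : μ.real N = 0 := by
    by_contra hne
    have hpos : 0 < p / (K + 1) * μ.real N :=
      mul_pos (by positivity) (lt_of_le_of_ne measureReal_nonneg (Ne.symm hne))
    obtain ⟨n, hn⟩ := exists_nat_gt (2 * ((K : ℝ) + 1) / (p / (K + 1) * μ.real N))
    rw [div_lt_iff₀ hpos] at hn
    have := hbound n
    linarith
  have hzero' : μ N = 0 := by
    rw [measureReal_def, ENNReal.toReal_eq_zero_iff] at hzero
    exact hzero.resolve_right (measure_ne_top μ N)
  filter_upwards [measure_eq_zero_iff_ae_notMem.1 hzero'] with ω hω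
  simp only [N, Set.mem_ofPred_eq, not_forall, not_le, count] at hω
  obtain ⟨t, ht⟩ := hω
  exact ⟨t, by exact_mod_cast ht⟩

/-- Almost surely the delay of step `s` is eventually smaller than `s` by any given amount. -/
theorem ae_eventually_delay_add_le (hint : Integrable (fun ω => (ξ 0 ω : ℝ)) μ) :
    ∀ᵐ ω ∂μ, ∀ c, ∀ᶠ s in atTop, ξ s ω + c ≤ s := by
  rw [ae_all_iff]
  intro c
  -- Borel–Cantelli: by identical distribution this is the tail sum of `ξ 0`, finite because its
  -- mean is.
  have hsum : ∑' j, μ {ω | j < ξ (j + c) ω} ≠ ∞ := by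
    have h1 := @tsum_prob_mem_Ioi_lt_top Ω ⟨μ⟩ ‹_› (fun ω => (ξ 0 ω : ℝ)) hint
      fun ω => Nat.cast_nonneg _
    refine ne_of_lt (lt_of_eq_of_lt (tsum_congr fun j => ?_) h1)
    rw [show {ω | j < ξ (j + c) ω} = ξ (j + c) ⁻¹' Set.Ioi j from rfl,
      (h.identDistrib (j + c)).measure_mem_eq measurableSet_Ioi]
    congr 1
    ext ω
    simp
  filter_upwards [ae_eventually_notMem hsum] with ω hω
  obtain ⟨T, hT⟩ := eventually_atTop.1 hω
  refine eventually_atTop.2 ⟨T + c, fun s hs => ?_⟩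
  have := hT (s - c) (by omega)
  rw [show s - c + c = s by omega] at this
  omega

/-! ### Growth of the expected number of leaves -/

theorem integral_count_succ (t : ℕ) :
    ∫ ω, count ξ θ (t + 1) ω ∂μ = ∫ ω, count ξ θ t ω ∂μ + ∫ ω, gainAt ξ θ t ω ∂μ := by
  simp only [count_succ]
  exact integral_add (h.integrable_count t) (h.integrable_gainAt t)

theorem one_le_integral_count (t : ℕ) : 1 ≤ ∫ ω, count ξ θ t ω ∂μ := by
  have := integral_mono (μ := μ) (integrable_const 1) (h.integrable_count t) (one_le_count t)
  simpa using this

theorem integral_count_mono : Monotone fun t => ∫ ω, count ξ θ t ω ∂μ := fun s t hst =>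
  integral_mono (h.integrable_count s) (h.integrable_count t) fun ω => count_mono ω hst

theorem integrable_inv_count (t : ℕ) : Integrable (fun ω => (count ξ θ t ω)⁻¹) μ :=
  .of_bound (h.measurable_count t).inv.aestronglyMeasurable 1 <| ae_of_all _ fun ω => by
    rw [Real.norm_of_nonneg (inv_nonneg.2 (count_pos t ω).le)]
    exact inv_le_one_of_one_le₀ (one_le_count t ω)

/-- Jensen's inequality for the reciprocal, by integrating its tangent line at the mean `a`. -/
theorem inv_integral_count_le (t : ℕ) :
    (∫ ω, count ξ θ t ω ∂μ)⁻¹ ≤ ∫ ω, (count ξ θ t ω)⁻¹ ∂μ := by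
  set a := ∫ ω, count ξ θ t ω ∂μ with ha
  have ha0 : 0 < a := zero_lt_one.trans_le (h.one_le_integral_count t)
  have htan : ∀ ω, 2 * a⁻¹ - a⁻¹ ^ 2 * count ξ θ t ω ≤ (count ξ θ t ω)⁻¹ := by
    intro ω
    have hc := count_pos (ξ := ξ) (θ := θ) t ω
    have hsq : 0 ≤ (a⁻¹ * count ξ θ t ω - 1) ^ 2 * (count ξ θ t ω)⁻¹ := by positivity
    have : (a⁻¹ * count ξ θ t ω - 1) ^ 2 * (count ξ θ t ω)⁻¹ =
        a⁻¹ ^ 2 * count ξ θ t ω - 2 * a⁻¹ + (count ξ θ t ω)⁻¹ := by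
      field_simp
      ring
    linarith
  have hint := integral_mono (μ := μ)
    ((integrable_const (2 * a⁻¹)).sub ((h.integrable_count t).const_mul (a⁻¹ ^ 2)))
    (h.integrable_inv_count t) htan
  have hval : ∫ ω, (2 * a⁻¹ - a⁻¹ ^ 2 * count ξ θ t ω) ∂μ = a⁻¹ := by
    rw [integral_sub (integrable_const _) ((h.integrable_count t).const_mul _),
      integral_const_mul (a⁻¹ ^ 2), ← ha, integral_const, probReal_univ, one_smul]
    field_simp
    ring
  exact hval.symm.le.trans hint

/-- The lower bound for the expected number of leaves. -/
theorem mul_le_integral_count_sq (k n : ℕ) :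
    μ.real {ω | ξ 0 ω = k + 2} * n ≤ 2 * (∫ ω, count ξ θ (n + (k + 1)) ω ∂μ) ^ 2 := by
  set p := μ.real {ω | ξ 0 ω = k + 2} with hpdef
  have hp0 : 0 ≤ p := measureReal_nonneg
  have hp1 : p ≤ 1 := measureReal_le_one
  let l : ℕ → ℝ := fun t => ∫ ω, count ξ θ t ω ∂μ
  have hl1 : ∀ t, 1 ≤ l t := h.one_le_integral_count
  have hlm : Monotone l := h.integral_count_mono
  -- The basic lower bound with weight 1, Jensen for the reciprocal, and `gain / L ≤ gain` because
  -- `L ≥ 1`.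
  have hstep : ∀ s, p * ((l s)⁻¹ - (l (s + 1) - l s)) ≤ l (s + 1 + (k + 1)) - l (s + (k + 1)) := by
    intro s
    have hlow := h.mul_integral_le_integral_gainAt (s := s) (t := s + (k + 1)) (k := k) rfl
      (W := fun _ => 1) (@measurable_const _ _ _ (history ξ θ _ _) (1 : ℝ)) (fun _ => zero_le_one)
      fun _ => le_rfl
    simp only [one_mul] at hlow
    have e1 : l (s + 1 + (k + 1)) - l (s + (k + 1)) = ∫ ω, gainAt ξ θ (s + (k + 1)) ω ∂μ := by
      simp only [l]
      rw [show s + 1 + (k + 1) = s + (k + 1) + 1 by ring, h.integral_count_succ]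
      ring
    have e2 : l (s + 1) - l s = ∫ ω, gainAt ξ θ s ω ∂μ := by
      simp only [l]
      rw [h.integral_count_succ]
      ring
    rw [e1, e2]
    refine le_trans (mul_le_mul_of_nonneg_left ?_ hp0) hlow
    refine (sub_le_sub_right (h.inv_integral_count_le s) _).trans ?_
    rw [← integral_sub (h.integrable_inv_count s) (h.integrable_gainAt s)]
    refine integral_mono ((h.integrable_inv_count s).sub (h.integrable_gainAt s)) ?_ fun ω => ?_
    · refine .of_bound (((measurable_const.sub (h.measurable_gainAt s)).div
        (h.measurable_count s)).aestronglyMeasurable) 1 (ae_of_all _ fun ω => ?_)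
      have h1 := gainAt_le_one (ξ := ξ) (θ := θ) s ω
      have h2 := gainAt_nonneg (ξ := ξ) (θ := θ) s ω
      have h3 := one_le_count (ξ := ξ) (θ := θ) s ω
      rw [Real.norm_of_nonneg (div_nonneg (by linarith) (by linarith))]
      exact div_le_one_of_le₀ (by linarith) (by linarith)
    · have h2 := gainAt_nonneg (ξ := ξ) (θ := θ) s ω
      have h3 := one_le_count (ξ := ξ) (θ := θ) s ω
      have h4 : gainAt ξ θ s ω / count ξ θ s ω ≤ gainAt ξ θ s ω := div_le_self h2 h3
      simp only [sub_div, one_div]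
      linarith
  -- Both increments telescope, and by monotonicity each reciprocal is at least the last one.
  have hsum : p * (n * (l (n + (k + 1)))⁻¹ - (l n - l 0)) ≤
      l (n + (k + 1)) - l (0 + (k + 1)) := by
    rw [← Finset.sum_range_sub (fun s => l (s + (k + 1))), ← Finset.sum_range_sub l]
    refine le_trans ?_ (Finset.sum_le_sum fun s _ => hstep s)
    rw [← Finset.mul_sum, Finset.sum_sub_distrib (fun s => (l s)⁻¹)]
    refine mul_le_mul_of_nonneg_left (sub_le_sub_right ?_ _) hp0
    have hc : ∑ _s ∈ Finset.range n, (l (n + (k + 1)))⁻¹ = n * (l (n + (k + 1)))⁻¹ := by simp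
    rw [← hc]
    refine Finset.sum_le_sum fun s hs => ?_
    have := Finset.mem_range.1 hs
    exact inv_anti₀ (zero_lt_one.trans_le (hl1 s)) (hlm (by omega))
  change p * n ≤ 2 * l (n + (k + 1)) ^ 2
  set M := l (n + (k + 1)) with hM
  have hM0 : 0 < M := zero_lt_one.trans_le (hl1 _)
  have h1 : l n ≤ M := hlm (by omega)
  have h2 := hl1 0
  have h3 := hl1 (0 + (k + 1))
  have h4 : p * (l n - l 0) ≤ M := by
    calc p * (l n - l 0) ≤ p * M := mul_le_mul_of_nonneg_left (by linarith) hp0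
      _ ≤ M := mul_le_of_le_one_left hM0.le hp1
  have h5 : p * (n * M⁻¹) ≤ 2 * M := by
    rw [mul_sub] at hsum
    linarith
  calc p * n = p * (n * M⁻¹) * M := by field_simp
    _ ≤ 2 * M * M := mul_le_mul_of_nonneg_right h5 hM0.le
    _ = 2 * M ^ 2 := by ring

theorem integrable_count_sq (t : ℕ) : Integrable (fun ω => count ξ θ t ω ^ 2) μ :=
  .of_bound ((h.measurable_count t).pow_const 2).aestronglyMeasurable (((t : ℝ) + 1) ^ 2) <|
    ae_of_all _ fun ω => by
      rw [Real.norm_of_nonneg (by positivity)]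
      exact pow_le_pow_left₀ (count_pos t ω).le (count_le t ω) 2

/-- `L_t` is known before the driving number of step `t`, so the gain may be replaced by its
conditional probability. The weighted probability is then at most twice the delay. -/
theorem integral_count_mul_gainAt_le (hint : Integrable (fun ω => (ξ 0 ω : ℝ)) μ) (t : ℕ) :
    ∫ ω, count ξ θ t ω * gainAt ξ θ t ω ∂μ ≤ 2 * ∫ ω, (ξ 0 ω : ℝ) ∂μ := by
  have hcast : Measurable fun n : ℕ => (n : ℝ) := .of_discrete
  have hid : IdentDistrib (fun ω => (ξ t ω : ℝ)) (fun ω => (ξ 0 ω : ℝ)) μ μ :=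
    (h.identDistrib t).comp hcast
  rw [h.integral_mul_gainAt (measurable_count_history (by omega) le_rfl) (h.integrable_count t),
    ← hid.integral_eq, ← integral_const_mul]
  refine integral_mono (h.integrable_mul_lossRatio (h.integrable_count t) t)
    ((hid.integrable_iff.2 hint).const_mul 2) fun ω => ?_
  have h1 := card_leafSet_mul_card_sdiff_le (fun n => ξ n ω) (fun n => θ n ω) t (ξ t ω)
  have h2 := count_pos (ξ := ξ) (θ := θ) (t + 1 - max (ξ t ω) 1) ω
  unfold count at h2
  simp only [count]
  rw [← mul_div_assoc, div_le_iff₀ h2]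
  unfold leavesAt
  exact_mod_cast h1

/-- The upper bound for the second moment of the number of leaves. -/
theorem integral_count_sq_le (hint : Integrable (fun ω => (ξ 0 ω : ℝ)) μ) (t : ℕ) :
    ∫ ω, count ξ θ t ω ^ 2 ∂μ ≤ 1 + 6 * (∫ ω, (ξ 0 ω : ℝ) ∂μ) * t := by
  induction t with
  | zero => simp [count_zero]
  | succ t ih =>
    -- Expanding the square gives `2 L gain + gain²`, and `gain² ≤ L gain` since `gain ≤ 1 ≤ L`.
    have hle : ∫ ω, count ξ θ (t + 1) ω ^ 2 ∂μ ≤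
        ∫ ω, count ξ θ t ω ^ 2 + 3 * (count ξ θ t ω * gainAt ξ θ t ω) ∂μ := by
      refine integral_mono (h.integrable_count_sq (t + 1)) ((h.integrable_count_sq t).add
        ((h.integrable_mul_gainAt (h.integrable_count t) t).const_mul 3)) fun ω => ?_
      have h1 := gainAt_le_one (ξ := ξ) (θ := θ) t ω
      have h2 := gainAt_nonneg (ξ := ξ) (θ := θ) t ω
      have h3 := one_le_count (ξ := ξ) (θ := θ) t ω
      simp only [count_succ]
      nlinarith
    rw [integral_add (h.integrable_count_sq t)
      ((h.integrable_mul_gainAt (h.integrable_count t) t).const_mul 3), integral_const_mul] at hle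
    have := h.integral_count_mul_gainAt_le hint t
    push_cast
    linarith

theorem integral_count_isTheta (hint : Integrable (fun ω => (ξ 0 ω : ℝ)) μ) {k : ℕ}
    (hp : 0 < μ.real {ω | ξ 0 ω = k + 2}) :
    (fun t => ∫ ω, count ξ θ t ω ∂μ) =Θ[atTop] fun t : ℕ => (t : ℝ) ^ (1 / 2 : ℝ) := by
  set p := μ.real {ω | ξ 0 ω = k + 2} with hpdef
  set M := ∫ ω, (ξ 0 ω : ℝ) ∂μ with hM
  have hM0 : 0 ≤ M := integral_nonneg fun ω => Nat.cast_nonneg _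
  simp only [← Real.sqrt_eq_rpow]
  constructor
  · refine IsBigO.of_bound (1 + 3 * M) ?_
    filter_upwards [eventually_ge_atTop 1] with t ht
    have ht' : (1 : ℝ) ≤ t := by exact_mod_cast ht
    have hs : 0 < √(t : ℝ) := Real.sqrt_pos.2 (by linarith)
    have hsq : √(t : ℝ) ^ 2 = t := Real.sq_sqrt (by linarith)
    rw [Real.norm_of_nonneg (zero_le_one.trans (h.one_le_integral_count t)),
      Real.norm_of_nonneg hs.le]
    -- The weight `√t` balances the two terms, as the second moment is of order `t`.
    have hamgm : ∫ ω, 2 * √(t : ℝ) * count ξ θ t ω ∂μ ≤ ∫ ω, t + count ξ θ t ω ^ 2 ∂μ := by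
      refine integral_mono ((h.integrable_count t).const_mul _)
        ((integrable_const _).add (h.integrable_count_sq t)) fun ω => ?_
      have := sq_nonneg (√(t : ℝ) - count ξ θ t ω)
      simp only
      nlinarith
    rw [integral_const_mul, integral_add (integrable_const _) (h.integrable_count_sq t)] at hamgm
    have h2 := h.integral_count_sq_le hint t
    have h3 : 2 * √(t : ℝ) * ∫ ω, count ξ θ t ω ∂μ ≤ 2 * √(t : ℝ) * ((1 + 3 * M) * √(t : ℝ)) := by
      calc 2 * √(t : ℝ) * ∫ ω, count ξ θ t ω ∂μ ≤ t + (1 + 6 * M * t) := by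
            refine hamgm.trans ?_
            simpa using h2
        _ ≤ 2 * (1 + 3 * M) * t := by linarith
        _ = 2 * √(t : ℝ) * ((1 + 3 * M) * √(t : ℝ)) := by
            nth_rewrite 1 [← hsq]
            ring
    exact le_of_mul_le_mul_left h3 (by positivity)
  · refine IsBigO.of_bound (2 / √p) ?_
    -- From here on `t - (k + 1)` is at least `t / 2`, so the lower bound becomes `p t ≤ 4 (E
    -- L_t)²`; hence the constant `2 / √p`.
    filter_upwards [eventually_ge_atTop (2 * (k + 1))] with t ht
    have hs := Real.sqrt_nonneg (t : ℝ)
    have hl := h.one_le_integral_count t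
    have hsp : 0 < √p := Real.sqrt_pos.2 hp
    rw [Real.norm_of_nonneg (zero_le_one.trans hl), Real.norm_of_nonneg hs, div_mul_eq_mul_div,
      le_div_iff₀ hsp, ← Real.sqrt_mul (Nat.cast_nonneg t)]
    have h1 := h.mul_le_integral_count_sq k (t - (k + 1))
    rw [show t - (k + 1) + (k + 1) = t by omega] at h1
    have h2 : (t : ℝ) ≤ 2 * ((t - (k + 1) : ℕ) : ℝ) := by exact_mod_cast (by omega)
    refine Real.sqrt_le_iff.2 ⟨by linarith, ?_⟩
    have h3 : (t : ℝ) * p ≤ 2 * ((t - (k + 1) : ℕ) : ℝ) * p := mul_le_mul_of_nonneg_right h2 hp.le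
    nlinarith

end IsDriving

end LeafModel

end

/-! ### The main theorem -/

theorem theorem2p3 {Ω : Type*} [MeasurableSpace Ω] (μ : Measure Ω) [IsProbabilityMeasure μ]
    (ξ : ℕ → Ω → ℕ) (θ : ℕ → Ω → ℝ)
    (hξ_meas : ∀ n, Measurable (ξ n)) (hθ_meas : ∀ n, Measurable (θ n))
    (hξ_indep : iIndepFun ξ μ) (hξ_ident : ∀ n, IdentDistrib (ξ n) (ξ 0) μ μ)
    (hθ_indep : iIndepFun θ μ)
    (hθ_unif : ∀ n, μ.map (θ n) = volume.restrict (Set.Icc (0 : ℝ) 1))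
    (hξθ_indep : IndepFun (fun ω n => ξ n ω) (fun ω n => θ n ω) μ)
    (hξ_pos : ∀ᵐ ω ∂μ, 1 ≤ ξ 0 ω)
    (hξ_moment : ∃ δ : ℝ, 0 < δ ∧ Integrable (fun ω => (ξ 0 ω : ℝ) ^ (1 + δ)) μ)
    (hξ_async : ¬ ∀ᵐ ω ∂μ, ξ 0 ω = 1) :
    (∀ᵐ ω ∂μ, ∃ G : MarkedDigraph, G.IsLocallyFiniteDAG ∧
      Tendsto (fun t => MarkedDigraph.dStar
        (acm uniformLeaf (fun n => ξ n ω) (fun n => θ n ω) t) G) atTop (𝓝 0) ∧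
      G.ends.Infinite) ∧
    (∀ t, Integrable (fun ω =>
      ((acm uniformLeaf (fun n => ξ n ω) (fun n => θ n ω) t).numLeaves : ℝ)) μ) ∧
    (fun t : ℕ => ∫ ω,
      ((acm uniformLeaf (fun n => ξ n ω) (fun n => θ n ω) t).numLeaves : ℝ) ∂μ)
      =Θ[atTop] (fun t : ℕ => (t : ℝ) ^ (1 / 2 : ℝ)) := by
  have h : LeafModel.IsDriving μ ξ θ :=
    ⟨hξ_meas, hθ_meas, LeafModel.iIndep_sourceAlgebra hξ_indep hθ_indep hξθ_indep, hξ_ident,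
      hθ_unif⟩
  have hint : Integrable (fun ω => (ξ 0 ω : ℝ)) μ := by
    obtain ⟨δ, hδ, hi⟩ := hξ_moment
    have hcast : Measurable fun n : ℕ => (n : ℝ) := .of_discrete
    refine hi.mono' (hcast.comp (hξ_meas 0)).aestronglyMeasurable ?_
    filter_upwards [hξ_pos] with ω hω
    rw [Real.norm_of_nonneg (Nat.cast_nonneg _)]
    exact Real.self_le_rpow_of_one_le (by exact_mod_cast hω) (by linarith)
  -- A law on the positive integers other than the point mass at 1 charges some value `k + 2`.
  obtain ⟨k, hk⟩ : ∃ k, 0 < μ.real {ω | ξ 0 ω = k + 2} := by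
    by_contra! hall
    refine hξ_async ?_
    have hne : ∀ k, ∀ᵐ ω ∂μ, ξ 0 ω ≠ k + 2 := by
      intro k
      have h0 : μ {ω | ξ 0 ω = k + 2} = 0 := by
        have := le_antisymm (hall k) measureReal_nonneg
        rw [measureReal_def, ENNReal.toReal_eq_zero_iff] at this
        exact this.resolve_right (measure_ne_top μ _)
      exact measure_eq_zero_iff_ae_notMem.1 h0
    filter_upwards [hξ_pos, ae_all_iff.2 hne] with ω h1 h2
    by_contra hω
    exact h2 (ξ 0 ω - 2) (by omega)
  have hcount : ∀ t ω, ((acm uniformLeaf (fun n => ξ n ω) (fun n => θ n ω) t).numLeaves : ℝ) =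
      LeafModel.count ξ θ t ω := fun t ω => by
    rw [LeafModel.numLeaves_acm]
    rfl
  refine ⟨?_, ?_, ?_⟩
  · filter_upwards [ae_all_iff.2 fun v => h.ae_exists_parentAt_eq (Nat.le_add_left 1 (k + 1)) hk v,
      h.ae_exists_lt_card hk, h.ae_eventually_delay_add_le hint] with ω hchild hleaves hslow
    have hfin : ∀ v, {s | LeafModel.parent (fun n => ξ n ω) (fun n => θ n ω) s = v}.Finite :=
      fun v => LeafModel.finite_children hslow (hchild v)
    exact ⟨LeafModel.limitGraph _ _, LeafModel.isLocallyFiniteDAG_limitGraph hfin,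
      LeafModel.tendsto_dStar_limitGraph hfin,
      LeafModel.ends_limitGraph_infinite hchild hleaves⟩
  · intro t
    simp only [hcount]
    exact h.integrable_count t
  · simp only [hcount]
    exact h.integral_count_isTheta hint hk
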